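/- Let $\Lambda\subset(0,\infty)$ be a finite or countable set, and let $\mathbb U_\Lambda$ be the Urysohn ultrametric space with spectrum $\Lambda$: the complete separable ultrametric space (unique up to isometry) whose set of nonzero distances is $\Lambda$ and such that, for all finite ultrametric spaces $X\subset Y$ with distances in $\Lambda\cup\{0\}$, every isometric embedding $X\to\mathbb U_\Lambda$ extends to an isometric embedding $Y\to\mathbb U_\Lambda$. Let $\mathbb I_\Lambda$ be the group of all isometries of $\mathbb U_\Lambda$ onto itself, with the topology of pointwise convergence. For $x\in \mathbb U_\Lambda$ let $\mathrm B^c(x,r)=\{y: d(x,y)\le r\}$ and $\mathrm B^o(x,r)=\{y: d(x,y)<r\}$. A pair $(\varepsilon,r)$ is called $\Lambda$-perfect if either $\varepsilon=c$ and $r\in\Lambda$, or $r=0$ when $0$ is not a limit point of $\Lambda$; or $\varepsilon=o$ and $r$ is the limit of a strictly increasing sequence of elements of $\Lambda$, or $r=\infty$ when $\Lambda$ is unbounded (so that $\mathrm B^o(x,\infty)=\mathbb U_\Lambda$). For a $\Lambda$-perfect pair let $\Xi_{\varepsilon,r}$ be the set of all balls $\mathrm B^\varepsilon(x,r)$, $x\in\mathbb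 U_\Lambda$; the group $\mathbb I_\Lambda$ permutes these balls and so acts unitarily on $\ell^2(\Xi_{\varepsilon,r})$. Let $\rho$ be an irreducible unitary representation of $\mathbb I_\Lambda$, i.e. a strongly continuous homomorphism to the unitary group of a nonzero separable complex Hilbert space without invariant closed subspaces other than $0$ and the whole space. Then: ($1.3^\circ$) there are $N\ge 1$ and $\Lambda$-perfect pairs $(\varepsilon_1,r_1),\dots,(\varepsilon_N,r_N)$, not necessarily distinct, such that $\rho$ is equivalent to a subrepresentation of the Hilbert space tensor product $$\bigotimes_{j=1}^N \ell^2(\Xi_{\varepsilon_j,r_j});$$ ($1.3^{\circ\circ}$) there are $N\ge 1$ and mutually disjoint balls $\mathrm B_j=\mathrm B^{\varepsilon_j}(x_j,r_j)$, $j=1,\dots,N$, with $\Lambda$-perfect pairs $(\varepsilon_j,r_j)$, such that $\rho$ is equivalent to a subrepresentation of the quasiregular representation of $\mathbb I_\Lambda$ in $\ell^2$ on the homogeneous space $\mathbb I\{\mathrm B_j\}\backslash\mathbb I_\Lambda$, where $\mathbb I\{\mathrm B_j\}$ is the subgroup of all isometries that send each ball $\mathrm B_j$ to itself. -/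

import Mathlib

open Topology
open scoped ENNReal

universe u v

namespace UltraUrysohn

section Urysohn

/-- The spectrum of a metric space: the set of all its nonzero distances. -/
def spectrum (X : Type u) [MetricSpace X] : Set ℝ :=
  {t | ∃ x y : X, x ≠ y ∧ dist x y = t}

/-- `U` is an Urysohn ultrametric space with spectrum `Λ`: a complete separable ultrametric space
with spectrum exactly `Λ` such that for finite ultrametric spaces `X ⊆ Y` with distances in `Λ`
every isometric embedding `X → U` extends to an isometric embedding `Y → U`. -/
structure IsUrysohn (Λ : Set ℝ) (U : Type u) [MetricSpace U] : Prop where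
  ultrametric : IsUltrametricDist U
  complete : CompleteSpace U
  separable : TopologicalSpace.SeparableSpace U
  spectrum_eq : spectrum U = Λ
  extension : ∀ (Y : Type) [MetricSpace Y] [IsUltrametricDist Y] [Finite Y] (X : Set Y),
    spectrum Y ⊆ Λ → ∀ f : X → U, Isometry f →
      ∃ g : Y → U, Isometry g ∧ ∀ x : X, g x = f x

/-- Closed or open. -/
inductive BallKind
  | closed
  | opened

/-- The ball with center `a`, of the given kind and with radius `r ∈ [0, ∞]`;
the open ball of radius `∞` is the whole metric space. -/
def ball {U : Type u} [MetricSpace U] (ε : BallKind) (a : U) (r : ℝ≥0∞) : Set U :=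
  match ε with
  | .closed => Metric.closedEBall a r
  | .opened => Metric.eball a r

/-- `Λ`, with `0` added if `0` is not a limit point of `Λ`. -/
def closedRadii (Λ : Set ℝ) : Set ℝ :=
  Λ ∪ {t | t = 0 ∧ ¬ AccPt (0 : ℝ) (Filter.principal Λ)}

/-- The limits of strictly increasing sequences of elements of `Λ`. -/
def openRadii (Λ : Set ℝ) : Set ℝ :=
  {t | ∃ s : ℕ → ℝ, StrictMono s ∧ (∀ k, s k ∈ Λ) ∧ Filter.Tendsto s Filter.atTop (𝓝 t)}

/-- `Λ`-perfect pairs (kind of a ball, radius). -/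
def IsPerfectPair (Λ : Set ℝ) (ε : BallKind) (r : ℝ≥0∞) : Prop :=
  match ε with
  | .closed => ∃ t ∈ closedRadii Λ, r = ENNReal.ofReal t
  | .opened => (∃ t ∈ openRadii Λ, r = ENNReal.ofReal t) ∨ (r = ∞ ∧ ¬ BddAbove Λ)

variable {U : Type u} [MetricSpace U]

theorem image_ball (g : U ≃ᵢ U) (ε : BallKind) (a : U) (r : ℝ≥0∞) :
    g '' ball ε a r = ball ε (g a) r := by
  cases ε
  · exact g.image_closedEBall a r
  · exact g.image_eball a r

/-- The group of isometries carries the topology of pointwise convergence. -/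
instance isometryTopology : TopologicalSpace (U ≃ᵢ U) :=
  TopologicalSpace.induced (fun g : U ≃ᵢ U => (g : U → U)) inferInstance

/-- The set of all balls of the given kind and radius. -/
def Balls (U : Type u) [MetricSpace U] (ε : BallKind) (r : ℝ≥0∞) : Type u :=
  {B : Set U // ∃ a : U, B = ball ε a r}

/-- Isometries permute the balls of the given kind and radius. -/
instance ballsAction (ε : BallKind) (r : ℝ≥0∞) : MulAction (U ≃ᵢ U) (Balls U ε r) where
  smul g B := ⟨g '' B.1, by
    obtain ⟨a, ha⟩ := B.2
    exact ⟨g a, by rw [ha, image_ball]⟩⟩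
  one_smul B := Subtype.ext (Set.image_id B.1)
  mul_smul g h B := Subtype.ext (Set.image_comp g h B.1)

/-- The subgroup of the isometries that send each of the given sets to itself. -/
def setwiseStabilizer {ι : Type} (B : ι → Set U) : Subgroup (U ≃ᵢ U) where
  carrier := {g | ∀ j, g '' B j = B j}
  one_mem' := fun j => Set.image_id (B j)
  mul_mem' := fun {g h} hg hh j => by
    change (g ∘ h) '' B j = B j
    rw [Set.image_comp, hh j, hg j]
  inv_mem' := fun {g} hg j => by
    conv_lhs => rw [← hg j]
    rw [← Set.image_comp]
    have : (⇑g⁻¹ ∘ ⇑g) = id := funext fun x => IsometryEquiv.inv_apply_self g x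
    rw [this, Set.image_id]

end Urysohn

section Representations

variable {G : Type u} [Group G]
variable {H : Type v} [NormedAddCommGroup H] [InnerProductSpace ℂ H]

/-- A unitary action is continuous for the strong operator topology. -/
def StronglyContinuous [TopologicalSpace G] (ρ : G →* (H ≃ₗᵢ[ℂ] H)) : Prop :=
  ∀ x : H, Continuous fun g => ρ g x

/-- The space is nonzero, and `0` and the whole space are the only invariant closed subspaces. -/
def IsIrreducible (ρ : G →* (H ≃ₗᵢ[ℂ] H)) : Prop :=
  Nontrivial H ∧ ∀ W : Submodule ℂ H, IsClosed (W : Set H) →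
    (∀ g, ∀ x ∈ W, ρ g x ∈ W) → W = ⊥ ∨ W = ⊤

/-- `ρ` is unitarily equivalent to the restriction of `σ` to an invariant closed subspace,
namely to the range of an equivariant isometric embedding of Hilbert spaces. -/
def IsSubrepresentation {K : Type*} [NormedAddCommGroup K] [InnerProductSpace ℂ K]
    (ρ : G →* (H ≃ₗᵢ[ℂ] H)) (σ : G →* (K ≃ₗᵢ[ℂ] K)) : Prop :=
  ∃ V : H →ₗᵢ[ℂ] K, ∀ g x, V (ρ g x) = σ g (V x)

/-- The Hilbert space `ℓ²(Ω)`. -/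
abbrev EllTwo (Ω : Type u) : Type u := lp (fun _ : Ω => ℂ) 2

theorem memlp_perm {Ω : Type u} (e : Equiv.Perm Ω) (f : EllTwo Ω) :
    Memℓp (fun x => (f : Ω → ℂ) (e x)) 2 := by
  have h := lp.memℓp f
  rw [memℓp_gen_iff (by norm_num)] at h ⊢
  exact (e.summable_iff (f := fun x => ‖(f : Ω → ℂ) x‖ ^ (2 : ℝ≥0∞).toReal)).2 h

theorem norm_perm {Ω : Type u} (e : Equiv.Perm Ω) (f : EllTwo Ω) :
    ‖(⟨fun x => (f : Ω → ℂ) (e x), memlp_perm e f⟩ : EllTwo Ω)‖ = ‖f‖ := by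
  rw [lp.norm_eq_tsum_rpow (by norm_num), lp.norm_eq_tsum_rpow (by norm_num)]
  congr 1
  exact e.tsum_eq (fun x => ‖(f : Ω → ℂ) x‖ ^ (2 : ℝ≥0∞).toReal)

/-- The permutation representation in `ℓ²(Ω)`: `(g f)(x) = f (g⁻¹ x)`. -/
noncomputable def permRep (G : Type v) [Group G] (Ω : Type u) [MulAction G Ω] :
    G →* (EllTwo Ω ≃ₗᵢ[ℂ] EllTwo Ω) where
  toFun g :=
    { toFun := fun f => ⟨fun x => f (g⁻¹ • x), memlp_perm (MulAction.toPerm g⁻¹) f⟩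
      invFun := fun f => ⟨fun x => f (g • x), memlp_perm (MulAction.toPerm g) f⟩
      left_inv := fun f => lp.ext (funext fun x => congrArg _ (inv_smul_smul g x))
      right_inv := fun f => lp.ext (funext fun x => congrArg _ (smul_inv_smul g x))
      map_add' := fun _ _ => rfl
      map_smul' := fun _ _ => rfl
      norm_map' := fun f => norm_perm (MulAction.toPerm g⁻¹) f }
  map_one' := by
    ext f x
    change f ((1 : G)⁻¹ • x) = f x
    simp
  map_mul' g h := by
    ext f x
    change f ((g * h)⁻¹ • x) = f (h⁻¹ • g⁻¹ • x)
    rw [mul_inv_rev, mul_smul]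

/-- The representation `σ` in the Hilbert space `K` is the tensor product of the representations
`π j`: there is a multilinear map `(v j) ↦ ⊗ v j` into `K` with
`⟪⊗ v j, ⊗ w j⟫ = ∏ ⟪v j, w j⟫`, whose values span a dense subspace of `K`
(this is the Hilbert space tensor product, unique up to a canonical unitary map),
and `σ g (⊗ v j) = ⊗ (π j g (v j))`. -/
def IsTensorProduct {ι : Type} [Fintype ι] {E : ι → Type v}
    [∀ j, NormedAddCommGroup (E j)] [∀ j, InnerProductSpace ℂ (E j)]
    {K : Type v} [NormedAddCommGroup K] [InnerProductSpace ℂ K]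
    (π : ∀ j, G →* (E j ≃ₗᵢ[ℂ] E j)) (σ : G →* (K ≃ₗᵢ[ℂ] K)) : Prop :=
  CompleteSpace K ∧ ∃ τ : MultilinearMap ℂ E K,
    (∀ v w, inner ℂ (τ v) (τ w) = ∏ j, inner ℂ (v j) (w j)) ∧
    Dense (Submodule.span ℂ (Set.range τ) : Set K) ∧
    ∀ g v, σ g (τ v) = τ fun j => π j g (v j)

end Representations

end UltraUrysohn

/-! By strong continuity and averaging, some nonzero vector is fixed by all isometries moving
finitely many points `x i` by at most some `s > 0`; take as few points as possible.

The geometric heart is `IsUrysohn.map_fixedProj`: projecting a vector fixed near `y` to the vectors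
fixed near `x` yields a vector invariant under all isometries moving each `x i` no farther than its
distance to the nearest `y j` (or `s`). Minimality keeps the resulting balls apart. So if `ρ g v`
and `v'` are not orthogonal, sending `x i` to the nearest `g (x j)` is a permutation of the indices
that relates the local invariances of `v` and `v'` (`IsMinimalFamily.exists_matching`).

By irreducibility any two nonzero vectors have some nonorthogonal translates. This rigidity produces
a vector `v` that, for every ball `B(x i, u)`, is either fixed by the isometries supported in the
ball or orthogonal to all vectors so fixed. For each `i` the radii of the first kind form an initial
segment of `Λ`, that is, a perfect ball. These balls are disjoint, their stabilizer fixes `v`, and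
`⟪v, ρ g v⟫ ≠ 0` only if `g` permutes them (`IsUrysohn.exists_ball_family`).

The stabilizer has finite index in the group permuting the balls, so each vector of the orbit of `v`
is orthogonal to all but boundedly many others. Hence the matrix coefficients `⟪ρ g v, w⟫` define a
bounded equivariant operator to `ℓ²`, and Schur's lemma makes it a multiple of an isometry
(`IsIrreducible.isSubrepresentation_permRep`). The same `v` serves for tuples of balls and for the
quotient group space; `ℓ²` of a product is the tensor product. -/

namespace UltraUrysohn

/-! ### Extension and homogeneity of the Urysohn space -/

section Homogeneity

variable {Λ : Set ℝ} {U : Type u} [MetricSpace U]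

theorem IsUrysohn.dist_mem (hU : IsUrysohn Λ U) (x y : U) : dist x y = 0 ∨ dist x y ∈ Λ := by
  by_cases h : x = y
  · left; simp [h]
  · right
    rw [← hU.spectrum_eq]
    exact ⟨x, y, h, rfl⟩

/-- The distance function of a one-point extension of a finite family of points. -/
def onePointDist {k : ℕ} (a : Fin k → U) (φ : Fin k → ℝ) : Option (Fin k) → Option (Fin k) → ℝ
  | none, none => 0
  | none, some p => φ p
  | some p, none => φ p
  | some p, some q => dist (a p) (a q)

theorem onePointDist_max (hultra : IsUltrametricDist U) {k : ℕ} (a : Fin k → U) (φ : Fin k → ℝ)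
    (hφ : ∀ i, 0 < φ i)
    (h₁ : ∀ i j, φ i ≤ max (φ j) (dist (a i) (a j)))
    (h₂ : ∀ i j, dist (a i) (a j) ≤ max (φ i) (φ j)) (x y z : Option (Fin k)) :
    onePointDist a φ x z ≤ max (onePointDist a φ x y) (onePointDist a φ y z) := by
  rcases x with _ | p <;> rcases y with _ | q <;> rcases z with _ | r <;>
    simp only [onePointDist]
  · simp
  · simp
  · exact le_max_of_le_left (hφ q).le
  · rw [dist_comm]; exact h₁ r q
  · simp
  · exact h₂ p r
  · rw [max_comm]; exact h₁ p q
  · exact dist_triangle_max _ _ _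

theorem IsUrysohn.exists_dist_eq_of_injective (hpos : ∀ t ∈ Λ, 0 < t) (hU : IsUrysohn Λ U) {k : ℕ}
    (a : Fin k → U) (ha : Function.Injective a) (φ : Fin k → ℝ) (hφ : ∀ i, φ i ∈ Λ)
    (h₁ : ∀ i j, φ i ≤ max (φ j) (dist (a i) (a j)))
    (h₂ : ∀ i j, dist (a i) (a j) ≤ max (φ i) (φ j)) :
    ∃ y, ∀ i, dist y (a i) = φ i := by
  have hφ0 : ∀ i, 0 < φ i := fun i => hpos _ (hφ i)
  have hmax := onePointDist_max hU.ultrametric a φ hφ0 h₁ h₂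
  have hnn : ∀ x y, 0 ≤ onePointDist a φ x y := by
    rintro (_ | p) (_ | q) <;> simp [onePointDist, (hφ0 _).le]
  let m : MetricSpace (Option (Fin k)) :=
    { dist := onePointDist a φ
      dist_self := by rintro (_ | p) <;> simp [onePointDist]
      dist_comm := by rintro (_ | p) (_ | q) <;> simp [onePointDist, dist_comm]
      dist_triangle := fun x y z => (hmax x y z).trans
        (max_le_add_of_nonneg (hnn _ _) (hnn _ _))
      eq_of_dist_eq_zero := by
        rintro (_ | p) (_ | q) h
        · rfl
        · exact absurd h (hφ0 q).ne'
        · exact absurd h (hφ0 p).ne'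
        · exact congrArg _ (ha (dist_eq_zero.1 h)) }
  have hum : IsUltrametricDist (Option (Fin k)) := ⟨hmax⟩
  obtain ⟨g, hg, hgX⟩ := hU.extension (Option (Fin k)) {y | y.isSome} (by
    rintro t ⟨x, y, hxy, rfl⟩
    rcases x with _ | p <;> rcases y with _ | q
    · exact absurd rfl hxy
    · exact hφ q
    · exact hφ p
    · exact (hU.dist_mem (a p) (a q)).resolve_left fun h =>
        hxy (congrArg _ (ha (dist_eq_zero.1 h))))
    (fun x => a (x.1.get x.2)) (by
      refine Isometry.of_dist_eq ?_
      rintro ⟨_ | p, hp⟩ ⟨_ | q, hq⟩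
      · simp at hp
      · simp at hp
      · simp at hq
      · rfl)
  refine ⟨g none, fun i => ?_⟩
  have h := hgX ⟨some i, rfl⟩
  have h' : g (some i) = a i := h
  rw [← h', hg.dist_eq]
  rfl

/-- One-point extension property for finite families of points. -/
theorem IsUrysohn.exists_dist_eq (hpos : ∀ t ∈ Λ, 0 < t) (hU : IsUrysohn Λ U) {ι : Type*} [Finite ι]
    (a : ι → U) (φ : ι → ℝ) (hφ : ∀ i, φ i = 0 ∨ φ i ∈ Λ)
    (h₁ : ∀ i j, φ i ≤ max (φ j) (dist (a i) (a j)))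
    (h₂ : ∀ i j, dist (a i) (a j) ≤ max (φ i) (φ j)) :
    ∃ y, ∀ i, dist y (a i) = φ i := by
  have hnn : ∀ i, 0 ≤ φ i := fun i => (hφ i).elim (fun h => h.ge) fun h => (hpos _ h).le
  -- If some prescribed distance vanishes, the new point must be `a i` itself.
  by_cases h0 : ∃ i, φ i = 0
  · obtain ⟨i, hi⟩ := h0
    refine ⟨a i, fun j => le_antisymm ?_ ?_⟩
    · have := h₂ i j
      rwa [hi, max_eq_right (hnn j)] at this
    · have := h₁ j i
      rwa [hi, max_eq_right dist_nonneg, dist_comm] at this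
  push Not at h0
  -- The family may repeat points, so enumerate its range and pick one index `c p` for each point.
  obtain ⟨k, ⟨e⟩⟩ := Finite.exists_equiv_fin (Set.range a)
  choose c hc using fun p : Fin k => (e.symm p).2
  obtain ⟨y, hy⟩ := hU.exists_dist_eq_of_injective hpos (fun p => a (c p))
    (fun p q h => e.symm.injective (Subtype.ext (by rw [← hc p, ← hc q]; exact h)))
    (fun p => φ (c p)) (fun p => (hφ _).resolve_left (h0 _)) (fun p q => h₁ _ _) (fun p q => h₂ _ _)
  refine ⟨y, fun i => ?_⟩
  have hi : a (c (e ⟨a i, i, rfl⟩)) = a i := by rw [hc]; simp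
  have := hy (e ⟨a i, i, rfl⟩)
  rw [hi] at this
  rw [this]
  refine le_antisymm ?_ ?_
  · have := h₁ (c (e ⟨a i, i, rfl⟩)) i
    rwa [hi, dist_self, max_eq_left (hnn _)] at this
  · have := h₁ i (c (e ⟨a i, i, rfl⟩))
    rwa [hi, dist_self, max_eq_left (hnn _)] at this

theorem IsUrysohn.nonempty (hpos : ∀ t ∈ Λ, 0 < t) (hU : IsUrysohn Λ U) : Nonempty U :=
  have ⟨y, _⟩ := hU.exists_dist_eq hpos (ι := Fin 0) Fin.elim0 Fin.elim0 (fun i => i.elim0)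
    (fun i => i.elim0) fun i => i.elim0
  ⟨y⟩

/-- A relation that preserves distances. -/
def IsPartialIsometry (R : Set (U × U)) : Prop :=
  ∀ z ∈ R, ∀ w ∈ R, dist z.1 w.1 = dist z.2 w.2

/-- The value at `x` of the extended isometry is characterized by its distances to the second
components of `R`. It is the limit of the images of a sequence tending to `x`. -/
theorem IsPartialIsometry.exists_dist_eq [CompleteSpace U] {R : Set (U × U)}
    (hR : IsPartialIsometry R) (hd : Dense (Prod.fst '' R)) (x : U) :
    ∃ y, ∀ z ∈ R, dist x z.1 = dist y z.2 := by
  have hx : ∀ k : ℕ, ∃ z ∈ R, dist x z.1 < 1 / (k + 1) := fun k => by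
    obtain ⟨_, ⟨z, hz, rfl⟩, h⟩ := hd.exists_dist_lt x (Nat.one_div_pos_of_nat (α := ℝ) (n := k))
    exact ⟨z, hz, h⟩
  choose z hzR hz using hx
  have h1 : Filter.Tendsto (fun k => (z k).1) Filter.atTop (𝓝 x) := by
    rw [tendsto_iff_dist_tendsto_zero]
    refine squeeze_zero (fun _ => dist_nonneg) (fun k => ?_) tendsto_one_div_add_atTop_nhds_zero_nat
    rw [dist_comm]; exact (hz k).le
  have h2 : CauchySeq fun k => (z k).2 := by
    have := h1.cauchySeq
    rw [Metric.cauchySeq_iff] at this ⊢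
    intro ε hε
    obtain ⟨N, hN⟩ := this ε hε
    exact ⟨N, fun m hm n hn => by rw [← hR _ (hzR m) _ (hzR n)]; exact hN m hm n hn⟩
  obtain ⟨y, hy⟩ := cauchySeq_tendsto_of_complete h2
  refine ⟨y, fun w hw => ?_⟩
  refine tendsto_nhds_unique (h1.dist tendsto_const_nhds) ?_
  simp_rw [hR _ (hzR _) w hw]
  exact hy.dist tendsto_const_nhds

/-- This makes the extension isometric and, when one of the distances is zero, gives both inverse
identities. -/
theorem IsPartialIsometry.dist_eq {R : Set (U × U)}
    (hd : Dense (Prod.fst '' R)) {x x' y y' : U} (h : ∀ z ∈ R, dist x z.1 = dist y z.2)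
    (h' : ∀ z ∈ R, dist x' z.1 = dist y' z.2) : dist x x' = dist y y' := by
  refine le_antisymm ?_ ?_ <;> refine le_of_forall_pos_le_add fun ε hε => ?_
  all_goals
    obtain ⟨_, ⟨z, hz, rfl⟩, hxz⟩ := hd.exists_dist_lt x (half_pos hε)
    have e1 := h z hz
    have e2 := h' z hz
    have t1 := dist_triangle_left x x' z.1
    have t2 := dist_triangle_left y y' z.2
    have t3 := dist_triangle y' y z.2
    have t4 := dist_triangle x' x z.1
    rw [dist_comm x' x, dist_comm z.1] at *
    rw [dist_comm y' y] at *
    simp only [dist_comm z.1, dist_comm z.2] at *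
    linarith

theorem IsPartialIsometry.swap {R : Set (U × U)} (hR : IsPartialIsometry R) :
    IsPartialIsometry (Prod.swap ⁻¹' R) :=
  fun _ hz _ hw => (hR _ hz _ hw).symm

theorem image_fst_preimage_swap {U : Type*} (R : Set (U × U)) :
    Prod.fst '' (Prod.swap ⁻¹' R) = Prod.snd '' R := by
  ext x; simp

theorem IsPartialIsometry.exists_isometryEquiv [CompleteSpace U] {R : Set (U × U)}
    (hR : IsPartialIsometry R) (hd : Dense (Prod.fst '' R)) (hd' : Dense (Prod.snd '' R)) :
    ∃ g : U ≃ᵢ U, ∀ z ∈ R, g z.1 = z.2 := by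
  have hd'' : Dense (Prod.fst '' (Prod.swap ⁻¹' R)) := by rwa [image_fst_preimage_swap]
  choose f hf using hR.exists_dist_eq hd
  choose f' hf' using hR.swap.exists_dist_eq hd''
  have hf'2 : ∀ y, ∀ z ∈ R, dist (f' y) z.1 = dist y z.2 := fun y z hz => (hf' y z.swap hz).symm
  refine ⟨⟨⟨f, f', fun x => ?_, fun y => ?_⟩, Isometry.of_dist_eq fun x y =>
    (IsPartialIsometry.dist_eq hd (hf x) (hf y)).symm⟩, fun z hz => ?_⟩
  · have := IsPartialIsometry.dist_eq hd (hf x) (hf'2 (f x))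
    rw [dist_self, dist_eq_zero] at this
    exact this.symm
  · have := IsPartialIsometry.dist_eq hd (hf'2 y) (hf (f' y))
    rw [dist_self] at this
    exact (dist_eq_zero.1 this.symm).symm
  · have := hf z.1 z hz
    rw [dist_self] at this
    exact dist_eq_zero.1 this.symm

theorem IsUrysohn.exists_insert (hpos : ∀ t ∈ Λ, 0 < t) (hU : IsUrysohn Λ U)
    {R : Set (U × U)} (hfin : R.Finite) (hR : IsPartialIsometry R) (x : U) :
    ∃ y, IsPartialIsometry (insert (x, y) R) := by
  have := hU.ultrametric
  have := hfin.to_subtype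
  obtain ⟨y, hy⟩ := hU.exists_dist_eq hpos (fun z : R => z.1.2) (fun z => dist x z.1.1)
    (fun z => hU.dist_mem _ _) (fun z w => by
      rw [← hR _ z.2 _ w.2, dist_comm z.1.1]; exact dist_triangle_max _ _ _) (fun z w => by
      rw [← hR _ z.2 _ w.2, dist_comm x]; exact dist_triangle_max _ _ _)
  refine ⟨y, ?_⟩
  rintro z (rfl | hz) w (rfl | hw)
  · simp
  · exact (hy ⟨w, hw⟩).symm
  · rw [dist_comm, dist_comm z.2]; exact (hy ⟨z, hz⟩).symm
  · exact hR _ hz _ hw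

/-- Finite partial isometries. -/
def FinPartialIsometry (U : Type u) [MetricSpace U] : Type u :=
  {R : Set (U × U) // R.Finite ∧ IsPartialIsometry R}

theorem IsUrysohn.exists_extend (hpos : ∀ t ∈ Λ, 0 < t) (hU : IsUrysohn Λ U)
    (R : FinPartialIsometry U) (x : U) :
    ∃ R' : FinPartialIsometry U, R.1 ⊆ R'.1 ∧ x ∈ Prod.fst '' R'.1 ∧ x ∈ Prod.snd '' R'.1 := by
  obtain ⟨y, hy⟩ := hU.exists_insert hpos R.2.1 R.2.2 x
  have hfin : (insert (x, y) R.1).Finite := R.2.1.insert _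
  obtain ⟨y', hy'⟩ := hU.exists_insert hpos (R := Prod.swap ⁻¹' (insert (x, y) R.1))
    (hfin.preimage Prod.swap_injective.injOn) hy.swap x
  refine ⟨⟨insert (y', x) (insert (x, y) R.1), hfin.insert _, ?_⟩, ?_, ?_, ?_⟩
  · have := hy'.swap
    convert this using 1
    ext ⟨p, q⟩
    simp [and_comm]
  · exact (Set.subset_insert _ _).trans (Set.subset_insert _ _)
  · exact ⟨(x, y), by simp, rfl⟩
  · exact ⟨(y', x), by simp, rfl⟩

/-- Homogeneity: isometries between finite families of points extend to the whole space. -/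
theorem IsUrysohn.exists_isometryEquiv (hpos : ∀ t ∈ Λ, 0 < t) (hU : IsUrysohn Λ U)
    {ι : Type*} [Finite ι] (a b : ι → U) (hab : ∀ i j, dist (a i) (a j) = dist (b i) (b j)) :
    ∃ g : U ≃ᵢ U, ∀ i, g (a i) = b i := by
  have := hU.nonempty hpos
  have := hU.separable
  have := hU.complete
  choose ext hext using hU.exists_extend hpos
  let R₀ : FinPartialIsometry U := ⟨Set.range fun i => (a i, b i), Set.finite_range _, by
    rintro _ ⟨i, rfl⟩ _ ⟨j, rfl⟩; exact hab i j⟩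
  -- Back and forth: each step puts the next term of a dense sequence into both the domain and the
  -- range.
  let R : ℕ → FinPartialIsometry U := fun n =>
    Nat.rec R₀ (fun k S => ext S (TopologicalSpace.denseSeq U k)) n
  have hR : ∀ n, R (n + 1) = ext (R n) (TopologicalSpace.denseSeq U n) := fun n => rfl
  have hmono : Monotone fun n => (R n).1 :=
    monotone_nat_of_le_succ fun n => by rw [hR]; exact (hext _ _).1
  have hiso : IsPartialIsometry (⋃ n, (R n).1) := by
    intro z hz w hw
    obtain ⟨m, hm⟩ := Set.mem_iUnion.1 hz
    obtain ⟨n, hn⟩ := Set.mem_iUnion.1 hw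
    exact (R (max m n)).2.2 z (hmono (le_max_left _ _) hm) w (hmono (le_max_right _ _) hn)
  have hsub : ∀ n, (R (n + 1)).1 ⊆ ⋃ n, (R n).1 := fun n => Set.subset_iUnion (fun n => (R n).1) (n + 1)
  obtain ⟨g, hg⟩ := hiso.exists_isometryEquiv
    ((TopologicalSpace.denseRange_denseSeq U).mono (by
      rintro _ ⟨n, rfl⟩
      exact Set.image_mono (hsub n) (by rw [hR]; exact (hext _ _).2.1)))
    ((TopologicalSpace.denseRange_denseSeq U).mono (by
      rintro _ ⟨n, rfl⟩
      exact Set.image_mono (hsub n) (by rw [hR]; exact (hext _ _).2.2)))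
  exact ⟨g, fun i => hg (a i, b i) (Set.mem_iUnion.2 ⟨0, i, rfl⟩)⟩

end Homogeneity

/-! ### Vectors fixed by a subgroup -/

section FixedVectors

variable {G : Type*} [Group G] {H : Type v} [NormedAddCommGroup H] [InnerProductSpace ℂ H]
  (ρ : G →* (H ≃ₗᵢ[ℂ] H))

theorem map_mul_apply (g h : G) (v : H) : ρ (g * h) v = ρ g (ρ h v) := by
  rw [map_mul]; rfl

theorem map_one_apply (v : H) : ρ 1 v = v := by
  rw [map_one]; rfl

theorem map_map_inv (g : G) (v : H) : ρ g (ρ g⁻¹ v) = v := by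
  rw [← map_mul_apply, mul_inv_cancel, map_one_apply]

theorem inner_map_left (g : G) (v w : H) : inner ℂ (ρ g v) w = inner ℂ v (ρ g⁻¹ w) := by
  rw [← (ρ g).inner_map_map v, map_map_inv]

/-- The subspace of vectors fixed by a subgroup. -/
def fixedSpace (K : Subgroup G) : Submodule ℂ H where
  carrier := {v | ∀ g ∈ K, ρ g v = v}
  zero_mem' := fun g _ => map_zero (ρ g)
  add_mem' := fun {v w} hv hw g hg => by rw [map_add, hv g hg, hw g hg]
  smul_mem' := fun c v hv g hg => by rw [map_smul, hv g hg]

variable {ρ} in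
theorem mem_fixedSpace {K : Subgroup G} {v : H} : v ∈ fixedSpace ρ K ↔ ∀ g ∈ K, ρ g v = v :=
  Iff.rfl

theorem fixedSpace_anti {K K' : Subgroup G} (h : K ≤ K') : fixedSpace ρ K' ≤ fixedSpace ρ K :=
  fun _ hv g hg => hv g (h hg)

theorem isClosed_fixedSpace (K : Subgroup G) : IsClosed (fixedSpace ρ K : Set H) := by
  have : (fixedSpace ρ K : Set H) = ⋂ g ∈ K, {v | ρ g v = v} := by
    ext v; simp [mem_fixedSpace]
  rw [this]
  exact isClosed_biInter fun g _ => isClosed_eq (ρ g).continuous continuous_id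

variable [CompleteSpace H]

instance completeSpace_fixedSpace (K : Subgroup G) : CompleteSpace (fixedSpace ρ K) :=
  (isClosed_fixedSpace ρ K).completeSpace_coe

/-- The orthogonal projection onto the space of vectors fixed by a subgroup. -/
noncomputable def fixedProj (K : Subgroup G) : H →L[ℂ] H := (fixedSpace ρ K).starProjection

theorem fixedProj_mem (K : Subgroup G) (v : H) : fixedProj ρ K v ∈ fixedSpace ρ K :=
  Submodule.starProjection_apply_mem _ v

variable {ρ} in
theorem fixedProj_eq_self {K : Subgroup G} {v : H} (hv : v ∈ fixedSpace ρ K) :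
    fixedProj ρ K v = v :=
  Submodule.starProjection_eq_self_iff.2 hv

variable {ρ} in
theorem mem_fixedSpace_of_fixedProj_eq {K : Subgroup G} {v : H} (hv : fixedProj ρ K v = v) :
    v ∈ fixedSpace ρ K :=
  Submodule.starProjection_eq_self_iff.1 hv

theorem inner_fixedProj (K : Subgroup G) (v w : H) :
    inner ℂ (fixedProj ρ K v) w = inner ℂ v (fixedProj ρ K w) :=
  Submodule.inner_starProjection_left_eq_right _ v w

variable {ρ} in
theorem inner_fixedProj_of_mem {K : Subgroup G} {w : H} (hw : w ∈ fixedSpace ρ K) (v : H) :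
    inner ℂ (fixedProj ρ K v) w = inner ℂ v w := by
  rw [inner_fixedProj, fixedProj_eq_self hw]

variable {ρ} in
theorem fixedProj_ne_zero {K : Subgroup G} {v w : H} (hw : w ∈ fixedSpace ρ K)
    (h : inner ℂ v w ≠ 0) : fixedProj ρ K v ≠ 0 := fun h0 => h <| by
  rw [← inner_fixedProj_of_mem hw, h0, inner_zero_left]

variable {ρ} in
-- Since `K` normalizes `K'`, it preserves the fixed space of `K'` and so commutes with the
-- projection to it.
theorem fixedProj_mem_fixedSpace {K K' : Subgroup G}
    (hn : ∀ g ∈ K, ∀ h ∈ K', g * h * g⁻¹ ∈ K') {v : H} (hv : v ∈ fixedSpace ρ K) :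
    fixedProj ρ K' v ∈ fixedSpace ρ K := by
  have key : ∀ g ∈ K, ∀ w ∈ fixedSpace ρ K', ρ g w ∈ fixedSpace ρ K' := by
    intro g hg w hw h hh
    have := hn g⁻¹ (K.inv_mem hg) h hh
    have h2 := hw _ this
    rw [inv_inv] at h2
    rw [map_mul_apply, map_mul_apply] at h2
    rw [← map_map_inv ρ g (ρ h (ρ g w)), h2]
  intro g hg
  symm
  refine Submodule.eq_starProjection_of_mem_orthogonal (key g hg _ (fixedProj_mem ρ K' v)) ?_
  rw [Submodule.mem_orthogonal]
  intro w hw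
  have h1 : v - ρ g (fixedProj ρ K' v) = ρ g (v - fixedProj ρ K' v) := by
    rw [map_sub, hv g hg]
  have h2 : inner ℂ (ρ g⁻¹ w) (v - fixedProj ρ K' v) = 0 :=
    (Submodule.mem_orthogonal _ _).1 ((fixedSpace ρ K').sub_starProjection_mem_orthogonal v) _
      (key _ (K.inv_mem hg) w hw)
  rw [h1, ← h2, inner_map_left, inv_inv]

variable {ρ} in
-- By self-adjointness, an operator preserving the fixed space also preserves its orthogonal
-- complement.
theorem fixedProj_fixedProj_eq_zero {K K' : Subgroup G}
    (h : ∀ v ∈ fixedSpace ρ K, fixedProj ρ K' v ∈ fixedSpace ρ K) {v : H}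
    (hv : fixedProj ρ K v = 0) : fixedProj ρ K (fixedProj ρ K' v) = 0 := by
  refine ext_inner_right ℂ fun w => ?_
  rw [inner_fixedProj, inner_fixedProj, ← fixedProj_eq_self (h _ (fixedProj_mem ρ K w)),
    ← inner_fixedProj, hv, inner_zero_left, inner_zero_left]

/-- The closed span `W` of the orbit is invariant, so the component of the projection `T` orthogonal
to `W` is again fixed. Being orthogonal to `w`, it is orthogonal to `T` and therefore zero. -/
theorem fixedProj_mem_closure (K : Subgroup G) (w : H) :
    fixedProj ρ K w ∈ closure (Submodule.span ℂ {x | ∃ g ∈ K, ρ g w = x} : Set H) := by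
  set W := (Submodule.span ℂ {x | ∃ g ∈ K, ρ g w = x}).topologicalClosure with hW
  have hWc : IsClosed (W : Set H) := Submodule.isClosed_topologicalClosure _
  have : CompleteSpace W := hWc.completeSpace_coe
  have hinv : ∀ g ∈ K, ∀ x ∈ W, ρ g x ∈ W := by
    intro g hg x hx
    have h1 : Submodule.span ℂ {x | ∃ g ∈ K, ρ g w = x} ≤
        W.comap (ρ g).toLinearEquiv.toLinearMap := by
      rw [Submodule.span_le]
      rintro _ ⟨h, hh, rfl⟩
      refine Submodule.le_topologicalClosure _ (Submodule.subset_span ⟨g * h, K.mul_mem hg hh, ?_⟩)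
      exact map_mul_apply ρ g h w
    exact (Submodule.topologicalClosure_minimal _ h1 (hWc.preimage (ρ g).continuous)) hx
  set T := fixedProj ρ K w
  have hT' : W.starProjection T ∈ fixedSpace ρ K := by
    intro g hg
    symm
    refine Submodule.eq_starProjection_of_mem_orthogonal
      (hinv g hg _ (Submodule.starProjection_apply_mem _ _)) ?_
    rw [Submodule.mem_orthogonal]
    intro x hx
    have h1 : T - ρ g (W.starProjection T) = ρ g (T - W.starProjection T) := by
      rw [map_sub, fixedProj_mem ρ K w g hg]
    rw [h1, ← inv_inv g, ← inner_map_left]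
    exact (Submodule.mem_orthogonal _ _).1 (W.sub_starProjection_mem_orthogonal T) _
      (hinv _ (K.inv_mem hg) x hx)
  have hwW : w ∈ W := Submodule.le_topologicalClosure _
    (Submodule.subset_span ⟨1, K.one_mem, map_one_apply ρ w⟩)
  have ho : ∀ x ∈ W, inner ℂ x (T - W.starProjection T) = 0 :=
    (Submodule.mem_orthogonal _ _).1 (W.sub_starProjection_mem_orthogonal T)
  have h0 : inner ℂ (T - W.starProjection T) (T - W.starProjection T) = 0 := by
    rw [inner_sub_left (𝕜 := ℂ) T, ho _ (Submodule.starProjection_apply_mem _ _), sub_zero,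
      inner_fixedProj_of_mem (Submodule.sub_mem _ (fixedProj_mem ρ K w) hT'), ho _ hwW]
  rw [inner_self_eq_zero, sub_eq_zero] at h0
  have h3 : T ∈ W := by
    rw [h0]; exact Submodule.starProjection_apply_mem _ _
  exact h3

/-- A vector that is moved little by a subgroup is near a nonzero fixed vector. -/
theorem fixedSpace_ne_bot (K : Subgroup G) {v : H} {r : ℝ} (hr : r < ‖v‖)
    (h : ∀ g ∈ K, ‖ρ g v - v‖ ≤ r) : fixedSpace ρ K ≠ ⊥ := by
  let : InnerProductSpace ℝ H := InnerProductSpace.complexToReal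
  set O : Set H := {x | ∃ g ∈ K, ρ g v = x}
  set C := closedConvexHull ℝ O
  have hvO : v ∈ O := ⟨1, K.one_mem, map_one_apply ρ v⟩
  have hCc : IsClosed C := isClosed_closedConvexHull
  have hCx : Convex ℝ C := convex_closedConvexHull
  have hinv : ∀ g ∈ K, ∀ x ∈ C, ρ g x ∈ C := by
    intro g hg x hx
    have : C ⊆ (ρ g) ⁻¹' C := by
      refine closedConvexHull_min ?_ ?_ (hCc.preimage (ρ g).continuous)
      · rintro _ ⟨k, hk, rfl⟩
        refine subset_closedConvexHull ⟨g * k, K.mul_mem hg hk, ?_⟩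
        exact map_mul_apply ρ g k v
      · exact hCx.linear_preimage ((ρ g).toLinearEquiv.toLinearMap.restrictScalars ℝ)
    exact this hx
  -- The shortest vector of the closed convex hull of the orbit is fixed because it is unique, and
  -- nonzero because the hull stays within `r < ‖v‖` of `v`.
  obtain ⟨c, hcC, hc⟩ := exists_norm_eq_iInf_of_complete_convex
    ⟨v, subset_closedConvexHull hvO⟩ hCc.isComplete hCx (0 : H)
  rw [norm_eq_iInf_iff_real_inner_le_zero hCx hcC] at hc
  have hball : C ⊆ Metric.closedBall v r := by
    refine closedConvexHull_min ?_ (convex_closedBall v r) Metric.isClosed_closedBall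
    rintro _ ⟨g, hg, rfl⟩
    rw [Metric.mem_closedBall, dist_eq_norm]
    exact h g hg
  have hc0 : c ≠ 0 := by
    rintro rfl
    have := hball hcC
    rw [Metric.mem_closedBall, dist_eq_norm, zero_sub, norm_neg] at this
    linarith
  rw [Submodule.ne_bot_iff]
  refine ⟨c, fun g hg => ?_, hc0⟩
  have h1 := hc _ (hinv g hg c hcC)
  have h2 : ‖ρ g c - c‖ ^ 2 = 0 := by
    refine le_antisymm ?_ (sq_nonneg _)
    have h3 := norm_sub_sq_real (ρ g c) c
    rw [(ρ g).norm_map] at h3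
    rw [zero_sub, inner_neg_left, inner_sub_right, real_inner_self_eq_norm_sq,
      real_inner_comm] at h1
    linarith
  exact sub_eq_zero.1 (norm_eq_zero.1 (pow_eq_zero_iff (two_ne_zero)|>.1 h2))

omit [CompleteSpace H] in
variable {ρ} in
theorem IsIrreducible.exists_inner_ne_zero (hirr : IsIrreducible ρ) {v w : H} (hv : v ≠ 0)
    (hw : w ≠ 0) : ∃ g, inner ℂ (ρ g v) w ≠ 0 := by
  by_contra! hcon
  let W : Submodule ℂ H :=
    { carrier := {x | ∀ g, inner ℂ (ρ g x) w = 0}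
      zero_mem' := fun g => by simp
      add_mem' := fun {x y} hx hy g => by rw [map_add, inner_add_left, hx, hy, add_zero]
      smul_mem' := fun c x hx g => by rw [map_smul, inner_smul_left, hx, mul_zero] }
  have hWc : IsClosed (W : Set H) := by
    have : (W : Set H) = ⋂ g, {x | inner ℂ (ρ g x) w = 0} := by
      ext x; simp [W]
    rw [this]
    exact isClosed_iInter fun g => isClosed_eq
      ((ρ g).continuous.inner continuous_const) continuous_const
  rcases hirr.2 W hWc (fun g x hx k => by rw [← map_mul_apply]; exact hx _) with h | h
  · have : v ∈ W := hcon
    rw [h] at this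
    exact hv this
  · have : w ∈ W := h ▸ Submodule.mem_top
    have := this 1
    rw [map_one_apply, inner_self_eq_zero] at this
    exact hw this

end FixedVectors

/-! ### Generic position and the enlarged invariance of projections -/

section Generic

variable {Λ : Set ℝ} {U : Type u} [MetricSpace U] [IsUltrametricDist U]

theorem dist_le_max_left (p q r : U) : dist p q ≤ max (dist r p) (dist r q) := by
  rw [dist_comm r p]; exact dist_triangle_max p r q

theorem dist_le_max_right (p q r : U) : dist r p ≤ max (dist r q) (dist p q) := by
  rw [dist_comm p q]; exact dist_triangle_max r q p

/-- These are the compatibility conditions for a new point having distance `dist a (x i)` to both `x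
i` and `k.symm (x i)`. -/
theorem dist_le_max_symm_apply {ι : Type*} (x : ι → U) (k : U ≃ᵢ U) (a : U)
    (ha : ∀ i, dist (k (x i)) (x i) ≤ dist a (x i)) (i j : ι) :
    dist (x i) (k.symm (x j)) ≤ max (dist a (x i)) (dist a (x j)) ∧
    dist a (x i) ≤ max (dist a (x j)) (dist (x i) (k.symm (x j))) ∧
    dist a (x j) ≤ max (dist a (x i)) (dist (x i) (k.symm (x j))) := by
  have e : dist (x i) (k.symm (x j)) = dist (k (x i)) (x j) := by
    rw [← k.dist_eq, k.apply_symm_apply]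
  have e' : dist (k (x j)) (x j) = dist (x j) (k.symm (x j)) := by
    rw [← k.dist_eq (x j), k.apply_symm_apply]
  have hi := ha i
  have hj := ha j
  rw [e'] at hj
  have t1 := dist_le_max_left (x i) (x j) a
  have t2 := dist_triangle_max (x i) (x j) (k.symm (x j))
  have t3 := dist_triangle_max (x i) (k (x i)) (x j)
  have t4 := dist_triangle_max (x i) (k.symm (x j)) (x j)
  have t5 := dist_le_max_right (x i) (x j) a
  have t6 := dist_le_max_right (x j) (x i) a
  rw [dist_comm (x j) (x i)] at t6
  rw [dist_comm (x i) (k (x i)), ← e] at t3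
  rw [dist_comm (k.symm (x j)) (x j)] at t4
  simp only [le_max_iff] at *
  refine ⟨?_, ?_, ?_⟩ <;> grind

/-- The copy of `Z` is built point by point with the one-point extension property. Equal distances
to `x i` and `k.symm (x i)` ensure that `k` does not change the distances from the copy to the `x
i`. -/
theorem IsUrysohn.exists_generic (hpos : ∀ t ∈ Λ, 0 < t) (hU : IsUrysohn Λ U)
    {ι : Type*} [Finite ι] (x : ι → U) (k : U ≃ᵢ U) (Z : Finset U)
    (hZ : ∀ z ∈ Z, ∀ i, dist (k (x i)) (x i) ≤ dist z (x i)) :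
    ∃ f : U → U, (∀ z ∈ Z, ∀ z' ∈ Z, dist (f z) (f z') = dist z z') ∧
      (∀ z ∈ Z, ∀ i, dist (f z) (x i) = dist z (x i)) ∧
      ∀ z ∈ Z, ∀ i, dist (f z) (k.symm (x i)) = dist z (x i) := by
  classical
  induction Z using Finset.induction_on with
  | empty => exact ⟨id, by simp⟩
  | insert a Z haZ ih =>
    obtain ⟨f, h₁, h₂, h₃⟩ := ih fun z hz => hZ z (Finset.mem_insert_of_mem hz)
    have hk := dist_le_max_symm_apply x k a (hZ a (Finset.mem_insert_self _ _))
    obtain ⟨y, hy⟩ := hU.exists_dist_eq hpos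
      (Sum.elim (fun z : Z => f z) (Sum.elim x fun i => k.symm (x i)))
      (Sum.elim (fun z : Z => dist a z) (Sum.elim (fun i => dist a (x i)) fun i => dist a (x i)))
      (by rintro (z | i | i) <;> exact hU.dist_mem _ _)
      (by
        rintro (z | i | i) (w | j | j) <;> simp only [Sum.elim_inl, Sum.elim_inr]
        · rw [h₁ z z.2 w w.2]; exact dist_le_max_right _ _ _
        · rw [h₂ z z.2]; exact dist_le_max_right _ _ _
        · rw [h₃ z z.2]; exact dist_le_max_right _ _ _
        · rw [dist_comm (x i), h₂ w w.2, dist_comm (w : U)]; exact dist_le_max_right _ _ _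
        · exact dist_le_max_right _ _ _
        · exact (hk i j).2.1
        · rw [dist_comm (k.symm _), h₃ w w.2, dist_comm (w : U)]; exact dist_le_max_right _ _ _
        · rw [dist_comm (k.symm _)]; exact (hk j i).2.2
        · rw [k.symm.dist_eq]; exact dist_le_max_right _ _ _)
      (by
        rintro (z | i | i) (w | j | j) <;> simp only [Sum.elim_inl, Sum.elim_inr]
        · rw [h₁ z z.2 w w.2]; exact dist_le_max_left _ _ _
        · rw [h₂ z z.2]; exact dist_le_max_left _ _ _
        · rw [h₃ z z.2]; exact dist_le_max_left _ _ _
        · rw [dist_comm (x i), h₂ w w.2, dist_comm (w : U)]; exact dist_le_max_left _ _ _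
        · exact dist_le_max_left _ _ _
        · exact (hk i j).1
        · rw [dist_comm (k.symm _), h₃ w w.2, dist_comm (w : U)]; exact dist_le_max_left _ _ _
        · rw [dist_comm (k.symm _), max_comm]; exact (hk j i).1
        · rw [k.symm.dist_eq]; exact dist_le_max_left _ _ _)
    have hne : ∀ z ∈ Z, z ≠ a := fun z hz h => haZ (h ▸ hz)
    have hyz : ∀ z ∈ Z, dist y (f z) = dist a z := fun z hz => hy (Sum.inl ⟨z, hz⟩)
    refine ⟨Function.update f a y, ?_, ?_, ?_⟩
    · intro z hz w hw
      rcases Finset.mem_insert.1 hz with rfl | hz' <;> rcases Finset.mem_insert.1 hw with rfl | hw'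
      · simp
      · rw [Function.update_self, Function.update_of_ne (hne w hw')]
        exact hyz w hw'
      · rw [Function.update_self, Function.update_of_ne (hne z hz'), dist_comm, dist_comm z]
        exact hyz z hz'
      · rw [Function.update_of_ne (hne z hz'), Function.update_of_ne (hne w hw')]
        exact h₁ z hz' w hw'
    · intro z hz i
      rcases Finset.mem_insert.1 hz with rfl | hz'
      · rw [Function.update_self]
        exact hy (Sum.inr (Sum.inl i))
      · rw [Function.update_of_ne (hne z hz')]
        exact h₂ z hz' i
    · intro z hz i
      rcases Finset.mem_insert.1 hz with rfl | hz'
      · rw [Function.update_self]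
        exact hy (Sum.inr (Sum.inr i))
      · rw [Function.update_of_ne (hne z hz')]
        exact h₃ z hz' i

/-- The subgroup of the isometries that move each of the given points by at most `s`. -/
def nearStabilizer (s : NNReal) {ι : Type*} (x : ι → U) : Subgroup (U ≃ᵢ U) where
  carrier := {g | ∀ i, dist (g (x i)) (x i) ≤ s}
  one_mem' := fun i => by
    change dist (x i) (x i) ≤ s
    simp
  mul_mem' := fun {g h} hg hh i => by
    change dist (g (h (x i))) (x i) ≤ s
    refine (dist_triangle_max _ (g (x i)) _).trans (max_le ?_ (hg i))
    rw [g.dist_eq]; exact hh i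
  inv_mem' := fun {g} hg i => by
    rw [← g.dist_eq, IsometryEquiv.apply_inv_self, dist_comm]
    exact hg i

/-- Here `h` moves `Z` into generic position; homogeneity over the `x i` then supplies an `a`
undoing the effect of `k` there. -/
theorem IsUrysohn.exists_moving (hpos : ∀ t ∈ Λ, 0 < t) (hU : IsUrysohn Λ U)
    {ι : Type*} [Finite ι] (x : ι → U) (k : U ≃ᵢ U) (Z : Finset U)
    (hZ : ∀ z ∈ Z, ∀ i, dist (k (x i)) (x i) ≤ dist z (x i)) :
    ∃ h a : U ≃ᵢ U, (∀ i, h (x i) = x i) ∧ (∀ i, a (x i) = x i) ∧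
      ∀ z ∈ Z, a (k (h z)) = h z := by
  obtain ⟨f, h₁, h₂, h₃⟩ := hU.exists_generic hpos x k Z hZ
  obtain ⟨h, hh⟩ := hU.exists_isometryEquiv hpos (Sum.elim x fun z : Z => (z : U))
    (Sum.elim x fun z : Z => f z) (by
      rintro (i | z) (j | w) <;> simp only [Sum.elim_inl, Sum.elim_inr]
      · rw [dist_comm, ← h₂ w w.2, dist_comm]
      · exact (h₂ z z.2 j).symm
      · exact (h₁ z z.2 w w.2).symm)
  obtain ⟨a, ha⟩ := hU.exists_isometryEquiv hpos (Sum.elim x fun z : Z => k (f z))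
    (Sum.elim x fun z : Z => f z) (by
      have key : ∀ (i : ι) (z : Z), dist (k (f z)) (x i) = dist (f z) (x i) := fun i z => by
        rw [h₂ z z.2, ← h₃ z z.2, ← k.dist_eq, ← k.dist_eq (f z), k.apply_symm_apply]
        rw [k.dist_eq]
      rintro (i | z) (j | w) <;> simp only [Sum.elim_inl, Sum.elim_inr]
      · rw [dist_comm, key, dist_comm]
      · exact key j z
      · exact k.dist_eq _ _)
  have hhz : ∀ z ∈ Z, h z = f z := fun z hz => hh (Sum.inr ⟨z, hz⟩)
  refine ⟨h, a, fun i => hh (Sum.inl i), fun i => ha (Sum.inl i), fun z hz => ?_⟩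
  rw [hhz z hz]
  exact ha (Sum.inr ⟨z, hz⟩)

variable {H : Type v} [NormedAddCommGroup H] [InnerProductSpace ℂ H] [CompleteSpace H]
  {ρ : (U ≃ᵢ U) →* (H ≃ₗᵢ[ℂ] H)}

/-- The projection of a vector fixed near `y` to the vectors fixed near `x` is fixed by
the stabilizers of the balls joining the points of `x` to the points of `y`. -/
theorem IsUrysohn.map_fixedProj (hpos : ∀ t ∈ Λ, 0 < t) (hU : IsUrysohn Λ U) {s : NNReal}
    {ι κ : Type*} [Finite ι] [Finite κ] (x : ι → U) (y : κ → U) {w : H}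
    (hw : w ∈ fixedSpace ρ (nearStabilizer s y)) (k : U ≃ᵢ U)
    (hk : ∀ i j, dist (k (x i)) (x i) ≤ max (s : ℝ) (dist (x i) (y j))) :
    ρ k (fixedProj ρ (nearStabilizer s x) w) = fixedProj ρ (nearStabilizer s x) w := by
  classical
  set K := nearStabilizer s x
  set T := fixedProj ρ K w
  have := Fintype.ofFinite κ
  have hT : T ∈ fixedSpace ρ K := fixedProj_mem _ _ _
  refine eq_of_forall_dist_le fun ε hε => ?_
  -- Approximate `T` by a combination `A` of finitely many translates `ρ (g m) w` with `g m ∈ K`;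
  -- only the points `g m (y j)` matter for these.
  obtain ⟨A, hA, hTA⟩ := Metric.mem_closure_iff.1 (fixedProj_mem_closure ρ K w) (ε / 2) (half_pos hε)
  obtain ⟨F, hF, hAF⟩ := Submodule.mem_span_finite_of_mem_span hA
  choose! g hgK hgw using fun m (hm : m ∈ F) => hF hm
  have hd : ∀ m ∈ F, ∀ i j, dist (x i) (y j) ≤ max (s : ℝ) (dist (g m (y j)) (x i)) := by
    intro m hm i j
    rw [← (g m).dist_eq, dist_comm (g m (y j))]
    exact (dist_triangle_max _ (x i) _).trans (max_le_max_right _ (hgK m hm i))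
  -- Only points farther than `s` from every `x i` need generic position; the others are covered by
  -- the tolerance `s`.
  obtain ⟨h, a, hh, ha, hZ⟩ := hU.exists_moving hpos x k
    (((F ×ˢ (Finset.univ : Finset κ)).image fun p => g p.1 (y p.2)).filter
      fun z => ∀ i, (s : ℝ) < dist z (x i)) (by
        intro z hz i
        simp only [Finset.mem_filter, Finset.mem_image, Finset.mem_product, Finset.mem_univ,
          and_true, Prod.exists] at hz
        obtain ⟨⟨m, j, hm, rfl⟩, hlt⟩ := hz
        have h2 := (hk i j).trans (max_le_max_left (s : ℝ) (hd m hm i j))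
        rwa [← max_assoc, max_self, max_eq_right (hlt i).le] at h2)
  have hfix : ∀ m ∈ F, ρ (a * k * h) m = ρ h m := by
    intro m hm
    have hmem : (h * g m)⁻¹ * (a * k * h) * g m ∈ nearStabilizer s y := by
      intro j
      rw [← (h * g m).dist_eq, ← IsometryEquiv.mul_apply, ← mul_assoc, mul_inv_cancel_left]
      change dist (a (k (h (g m (y j))))) (h (g m (y j))) ≤ s
      by_cases hlt : ∀ i, (s : ℝ) < dist (g m (y j)) (x i)
      · rw [hZ _ (Finset.mem_filter.2 ⟨Finset.mem_image.2 ⟨(m, j), by simp [hm], rfl⟩, hlt⟩)]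
        simp
      -- If the point is within `s` of `x i`, then `k` moves `x i` by at most `s`, so `h`, `k` and
      -- `a` all keep it in the `s`-ball around `x i`.
      · push Not at hlt
        obtain ⟨i, hi⟩ := hlt
        have h1 : dist (h (g m (y j))) (x i) ≤ s := by
          rw [← hh i, h.dist_eq]; exact hi
        have h2 : dist (k (x i)) (x i) ≤ s :=
          (hk i j).trans (max_le le_rfl ((hd m hm i j).trans (max_le le_rfl hi)))
        refine (dist_triangle_max _ (x i) _).trans (max_le ?_ (by rwa [dist_comm]))
        suffices dist (k (h (g m (y j)))) (x i) ≤ s by rwa [← a.dist_eq, ha i] at this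
        refine (dist_triangle_max _ (k (x i)) _).trans (max_le ?_ h2)
        rwa [k.dist_eq]
    have h3 := hw _ hmem
    rw [← hgw m hm, ← map_mul_apply, ← map_mul_apply]
    conv_rhs => rw [← h3, ← map_mul_apply]
    congr 2
    group
  have hfixA : ρ (a * k * h) A = ρ h A := by
    clear hA hTA
    induction hAF using Submodule.span_induction with
    | mem m hm => exact hfix m hm
    | zero => simp
    | add p q _ _ hp hq => rw [map_add, map_add, hp, hq]
    | smul c p _ hp => rw [map_smul, map_smul, hp]
  have hhT : ρ h T = T := hT h fun i => by rw [hh i, dist_self]; exact s.2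
  have haT : ρ a T = T := hT a fun i => by rw [ha i, dist_self]; exact s.2
  have e1 : ρ a (ρ k T) = ρ (a * k * h) T := by rw [map_mul_apply, map_mul_apply, hhT]
  calc dist (ρ k T) T = dist (ρ a (ρ k T)) (ρ a T) := ((ρ a).dist_map _ _).symm
    _ = dist (ρ (a * k * h) T) (ρ h T) := by rw [e1, haT, hhT]
    _ ≤ dist (ρ (a * k * h) T) (ρ (a * k * h) A) + dist (ρ (a * k * h) A) (ρ h T) :=
      dist_triangle _ _ _
    _ = dist T A + dist T A := by
      rw [(ρ (a * k * h)).dist_map, hfixA, (ρ h).dist_map, dist_comm A]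
    _ ≤ ε := by linarith

end Generic

/-! ### Isometries supported in a ball -/

section LocalSubgroups

variable {U : Type u} [MetricSpace U]

/-- The subgroup of the isometries that are the identity outside the given set. -/
def localSubgroup (S : Set U) : Subgroup (U ≃ᵢ U) where
  carrier := {g | ∀ y ∉ S, g y = y}
  one_mem' := fun _ _ => rfl
  mul_mem' := fun {g h} hg hh y hy => by
    change g (h y) = y
    rw [hh y hy, hg y hy]
  inv_mem' := fun {g} hg y hy => by
    conv_lhs => rw [← hg y hy]
    exact IsometryEquiv.inv_apply_self g y

theorem localSubgroup_mono {S S' : Set U} (h : S ⊆ S') : localSubgroup S ≤ localSubgroup S' :=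
  fun _ hg y hy => hg y fun hy' => hy (h hy')

theorem mem_of_mem_localSubgroup {S : Set U} {g : U ≃ᵢ U} (hg : g ∈ localSubgroup S) {y : U}
    (hy : y ∈ S) : g y ∈ S := by
  by_contra h
  have := hg _ h
  rw [g.injective.eq_iff] at this
  rw [this] at h
  exact h hy

theorem conj_mem_localSubgroup {S S' : Set U} {g h : U ≃ᵢ U} (hg : ∀ y ∈ S, g y ∈ S')
    (hh : h ∈ localSubgroup S) : g * h * g⁻¹ ∈ localSubgroup S' := by
  intro y hy
  have h1 : h (g⁻¹ y) = g⁻¹ y := hh _ fun h2 => hy (by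
    have := hg _ h2
    rwa [IsometryEquiv.apply_inv_self] at this)
  change g (h (g⁻¹ y)) = y
  rw [h1, IsometryEquiv.apply_inv_self]

theorem inv_map_mem_closedBall (g : U ≃ᵢ U) (a : U) (r : ℝ) :
    ∀ y ∈ Metric.closedBall (g a) r, g⁻¹ y ∈ Metric.closedBall a r := fun y hy => by
  rw [Metric.mem_closedBall, ← g.dist_eq, IsometryEquiv.apply_inv_self]; exact hy

variable [IsUltrametricDist U]

theorem dist_eq_of_mem_closedBall {a y y' z : U} {r : ℝ} (hy : dist y a ≤ r) (hy' : dist y' a ≤ r)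
    (hz : r < dist z a) : dist y z = dist y' z := by
  have t1 := dist_triangle_max z y a
  have t2 := dist_triangle_max z y' a
  have t3 := dist_triangle_max y a y'
  have t4 := dist_triangle_max y y' z
  have t5 := dist_triangle_max y' y z
  rw [dist_comm y' y, dist_comm a y'] at *
  rw [dist_comm z] at *
  simp only [le_max_iff] at *
  grind [dist_comm]

theorem mem_closedBall_iff_of_dist_le {k : U ≃ᵢ U} {a : U} {r : ℝ} (hk : dist (k a) a ≤ r) {y : U} :
    k y ∈ Metric.closedBall a r ↔ y ∈ Metric.closedBall a r := by
  conv_lhs => rw [IsUltrametricDist.closedBall_eq_of_mem (Metric.mem_closedBall.2 hk),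
    Metric.mem_closedBall, k.dist_eq]
  exact Iff.rfl

theorem symm_mem_closedBall_iff_of_dist_le {k : U ≃ᵢ U} {a : U} {r : ℝ} (hk : dist (k a) a ≤ r)
    {y : U} : k.symm y ∈ Metric.closedBall a r ↔ y ∈ Metric.closedBall a r := by
  rw [← mem_closedBall_iff_of_dist_le hk, k.apply_symm_apply]

open Classical in
/-- An isometry that preserves a ball can be replaced by the identity outside this ball. -/
theorem exists_mem_localSubgroup {k : U ≃ᵢ U} {a : U} {r : ℝ} (hk : dist (k a) a ≤ r) :
    ∃ l ∈ localSubgroup (Metric.closedBall a r), ∀ y ∈ Metric.closedBall a r, l y = k y := by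
  have h1 := fun y => mem_closedBall_iff_of_dist_le hk (y := y)
  have h2 := fun y => symm_mem_closedBall_iff_of_dist_le hk (y := y)
  let e : U ≃ U :=
    { toFun := fun y => if y ∈ Metric.closedBall a r then k y else y
      invFun := fun y => if y ∈ Metric.closedBall a r then k.symm y else y
      left_inv := fun y => by
        by_cases hy : y ∈ Metric.closedBall a r
        · simp only [hy, if_true, h1, k.symm_apply_apply]
        · simp only [hy, if_false]
      right_inv := fun y => by
        by_cases hy : y ∈ Metric.closedBall a r
        · simp only [hy, if_true, h2, k.apply_symm_apply]
        · simp only [hy, if_false] }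
  have key : ∀ y ∈ Metric.closedBall a r, ∀ z ∉ Metric.closedBall a r, dist (k y) z = dist y z :=
    fun y hy z hz => dist_eq_of_mem_closedBall ((h1 y).2 hy) hy (by simpa using hz)
  refine ⟨⟨e, Isometry.of_dist_eq fun y z => ?_⟩, fun y hy => if_neg hy, fun y hy => if_pos hy⟩
  change dist (if y ∈ Metric.closedBall a r then k y else y)
    (if z ∈ Metric.closedBall a r then k z else z) = dist y z
  split_ifs with hy hz hz
  · exact k.dist_eq _ _
  · exact key y hy z hz
  · rw [dist_comm, dist_comm y]; exact key z hz y hy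
  · rfl

end LocalSubgroups

/-! ### Minimal families, matchings and homogeneous vectors -/

section Homogeneous

variable {Λ : Set ℝ} {U : Type u} [MetricSpace U]
  {H : Type v} [NormedAddCommGroup H] [InnerProductSpace ℂ H] [CompleteSpace H]
  (ρ : (U ≃ᵢ U) →* (H ≃ₗᵢ[ℂ] H))

/-- The vectors fixed by the isometries that are the identity outside a closed ball. -/
abbrev localFixed (a : U) (r : ℝ) : Submodule ℂ H :=
  fixedSpace ρ (localSubgroup (Metric.closedBall a r))

/-- The projection to the vectors fixed by the isometries that are the identity outside a closed
ball. -/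
noncomputable abbrev localProj (a : U) (r : ℝ) : H →L[ℂ] H :=
  fixedProj ρ (localSubgroup (Metric.closedBall a r))

omit [CompleteSpace H] in
theorem localFixed_anti (a : U) {r r' : ℝ} (h : r ≤ r') : localFixed ρ a r' ≤ localFixed ρ a r :=
  fixedSpace_anti ρ (localSubgroup_mono (Metric.closedBall_subset_closedBall h))

variable {ρ}

omit [CompleteSpace H] in
theorem map_mem_fixedSpace {K K' : Subgroup (U ≃ᵢ U)} {g : U ≃ᵢ U}
    (h : ∀ k ∈ K', g⁻¹ * k * g ∈ K) {v : H} (hv : v ∈ fixedSpace ρ K) :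
    ρ g v ∈ fixedSpace ρ K' := fun k hk => by
  conv_rhs => rw [← hv _ (h k hk)]
  rw [← map_mul_apply, ← map_mul_apply]
  congr 2
  group

omit [CompleteSpace H] in
theorem map_mem_localFixed (g : U ≃ᵢ U) {a : U} {r : ℝ} {v : H} (hv : v ∈ localFixed ρ a r) :
    ρ g v ∈ localFixed ρ (g a) r :=
  map_mem_fixedSpace (fun k hk => by
    have := conj_mem_localSubgroup (inv_map_mem_closedBall g a r) hk
    rwa [inv_inv] at this) hv

omit [CompleteSpace H] in
theorem inv_map_mem_localFixed (g : U ≃ᵢ U) {a : U} {r : ℝ} {v : H}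
    (hv : v ∈ localFixed ρ (g a) r) : ρ g⁻¹ v ∈ localFixed ρ a r := by
  have := map_mem_localFixed g⁻¹ hv
  rwa [IsometryEquiv.inv_apply_self] at this

variable [IsUltrametricDist U]

omit [CompleteSpace H] in
theorem localFixed_congr {a b : U} {r : ℝ} (h : dist a b ≤ r) :
    localFixed ρ a r = localFixed ρ b r := by
  rw [localFixed, localFixed, IsUltrametricDist.closedBall_eq_of_mem (Metric.mem_closedBall.2 h)]

/-- Ultrametric balls are nested or disjoint: either the first local subgroup normalizes the second,
or it contains it and the projection does nothing. -/
theorem localProj_mem_localFixed (a b : U) (r r' : ℝ) {v : H} (hv : v ∈ localFixed ρ a r) :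
    localProj ρ b r' v ∈ localFixed ρ a r := by
  rcases IsUltrametricDist.closedBall_subset_trichotomy a b r r' with h | h | h
  · exact fixedProj_mem_fixedSpace (fun g hg k hk => mul_mem (mul_mem (localSubgroup_mono h hg) hk)
      (inv_mem (localSubgroup_mono h hg))) hv
  · rw [localProj, fixedProj_eq_self (fixedSpace_anti ρ (localSubgroup_mono h) hv)]
    exact hv
  · refine fixedProj_mem_fixedSpace (fun g hg k hk => conj_mem_localSubgroup (fun y hy => ?_) hk) hv
    rw [hg y fun hy' => h.le_bot ⟨hy', hy⟩]
    exact hy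

omit [CompleteSpace H] in
/-- A vector fixed near the points `x i` and fixed by the isometries that are the identity outside
the balls `B(x i, t i)` is fixed by all isometries that preserve these balls. -/
theorem map_eq_of_mem_localFixed {s : NNReal} {ι : Type*} [Finite ι] {x : ι → U} {v : H}
    (hv : v ∈ fixedSpace ρ (nearStabilizer s x)) {t : ι → ℝ} (ht : ∀ i, v ∈ localFixed ρ (x i) (t i))
    {k : U ≃ᵢ U} (hk : ∀ i, dist (k (x i)) (x i) ≤ t i) : ρ k v = v := by
  classical
  have := Fintype.ofFinite ι
  suffices h : ∀ (S : Finset ι) (k : U ≃ᵢ U), (∀ i, dist (k (x i)) (x i) ≤ t i) →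
      (∀ i ∉ S, k (x i) = x i) → ρ k v = v from
    h Finset.univ k hk fun i hi => absurd (Finset.mem_univ i) hi
  intro S
  induction S using Finset.induction_on with
  | empty =>
    intro k _ hk
    exact hv k fun i => by
      rw [hk i (Finset.notMem_empty i), dist_self]; exact s.2
  | insert i S _ ih =>
    intro k hk hkS
    -- Split off the part `l` of `k` inside the `i`-th ball; it fixes `v`, and `l⁻¹ * k` is the
    -- identity on that ball.
    obtain ⟨l, hl, hlk⟩ := exists_mem_localSubgroup (hk i)
    have hB : ∀ y ∈ Metric.closedBall (x i) (t i), (l⁻¹ * k) y = y := fun y hy => by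
      rw [IsometryEquiv.mul_apply, ← hlk y hy, IsometryEquiv.inv_apply_self]
    have hB' : ∀ y ∉ Metric.closedBall (x i) (t i), (l⁻¹ * k) y = k y := fun y hy =>
      inv_mem hl _ fun h => hy ((mem_closedBall_iff_of_dist_le (hk i)).1 h)
    have h1 := ih (l⁻¹ * k) (fun j => by
      by_cases hj : x j ∈ Metric.closedBall (x i) (t i)
      · rw [hB _ hj, dist_self]; exact dist_nonneg.trans (hk j)
      · rw [hB' _ hj]; exact hk j) (fun j hjS => by
      by_cases hj : x j ∈ Metric.closedBall (x i) (t i)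
      · exact hB _ hj
      · rw [hB' _ hj]
        refine hkS j fun h => ?_
        rcases Finset.mem_insert.1 h with rfl | h
        · exact hj (Metric.mem_closedBall_self (dist_nonneg.trans (hk j)))
        · exact hjS h)
    conv_rhs => rw [← ht i l hl, ← h1]
    rw [← map_mul_apply, mul_inv_cancel_left]

variable {s : NNReal} {ι : Type*} [Finite ι] {x : ι → U}

/-- The family `x` is minimal with the property that there are vectors fixed near `x`. -/
def IsMinimalFamily (ρ : (U ≃ᵢ U) →* (H ≃ₗᵢ[ℂ] H)) (s : NNReal) (x : ι → U) : Prop :=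
  ∀ i j, i ≠ j → fixedSpace ρ (nearStabilizer s fun l : {l // l ≠ i} => x l.1) = ⊥

omit [CompleteSpace H] [Finite ι] in
-- If `x j` lay in `B(x i, t i)`, control of `x j` would already control `x i`, and `x i` could be
-- dropped from the family.
theorem IsMinimalFamily.lt_dist (hx : IsMinimalFamily ρ s x) {T : H} (hT : T ≠ 0) {t : ι → ℝ}
    (hs : ∀ i, s ≤ t i) (h : ∀ k : U ≃ᵢ U, (∀ i, dist (k (x i)) (x i) ≤ t i) → ρ k T = T)
    {i j : ι} (hij : i ≠ j) : t i < dist (x i) (x j) := by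
  by_contra! hle
  refine hT ((Submodule.mem_bot ℂ).1 ?_)
  rw [← hx i j hij]
  intro g hg
  refine h g fun l => ?_
  by_cases hl : l = i
  · subst hl
    refine (dist_triangle_max _ (g (x j)) _).trans (max_le (by rwa [g.dist_eq]) ?_)
    exact (dist_triangle_max _ (x j) _).trans
      (max_le ((hg ⟨j, hij.symm⟩).trans (hs l)) (by rwa [dist_comm]))
  · exact (hg ⟨l, hl⟩).trans (hs l)

omit [CompleteSpace H] [Finite ι] in
-- For `T ≠ 0` the ball `B(x i, t i)` contains no other `x j`, so isometries supported in it leave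
-- those points in place.
theorem IsMinimalFamily.mem_localFixed (hx : IsMinimalFamily ρ s x) {T : H} {t : ι → ℝ}
    (hs : ∀ i, s ≤ t i) (h : ∀ k : U ≃ᵢ U, (∀ i, dist (k (x i)) (x i) ≤ t i) → ρ k T = T)
    (i : ι) : T ∈ localFixed ρ (x i) (t i) := by
  by_cases hT : T = 0
  · rw [hT]; exact Submodule.zero_mem _
  intro k hk
  refine h k fun j => ?_
  have ht : ∀ i, 0 ≤ t i := fun i => s.2.trans (hs i)
  by_cases hj : j = i
  · subst hj
    exact mem_of_mem_localSubgroup hk (Metric.mem_closedBall_self (ht j))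
  · rw [hk (x j), dist_self]
    · exact ht j
    · rw [Metric.mem_closedBall, dist_comm, not_le]
      exact hx.lt_dist hT hs h (Ne.symm hj)

omit [CompleteSpace H] [Finite ι] in
theorem IsMinimalFamily.mem_localFixed_of_le (hx : IsMinimalFamily ρ s x) {v : H}
    (hv : v ∈ fixedSpace ρ (nearStabilizer s x)) (i : ι) {u : ℝ} (hu : u ≤ s) :
    v ∈ localFixed ρ (x i) u :=
  localFixed_anti ρ _ hu (hx.mem_localFixed (t := fun _ => s) (fun _ => le_rfl) (fun k hk => hv k hk) i)

omit [Finite ι] in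
theorem IsMinimalFamily.localProj_mem (hx : IsMinimalFamily ρ s x) {v : H}
    (hv : v ∈ fixedSpace ρ (nearStabilizer s x)) (i : ι) (u : ℝ) :
    localProj ρ (x i) u v ∈ fixedSpace ρ (nearStabilizer s x) := by
  rcases le_total u s with hu | hu
  · rwa [localProj, fixedProj_eq_self (hx.mem_localFixed_of_le hv i hu)]
  · exact fixedProj_mem_fixedSpace (fun g hg k hk => conj_mem_localSubgroup (fun y hy =>
      (mem_closedBall_iff_of_dist_le ((hg i).trans hu)).2 hy) hk) hv

/-- The projection `T` of `ρ g v` has overlap with both `ρ g v` and `v'`, and it is fixed locally in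
the balls `B(x i, t i)`, each of which contains the point `g (x (σ i))` nearest to `x i`. -/
theorem IsMinimalFamily.exists_matching (hpos : ∀ t ∈ Λ, 0 < t) (hU : IsUrysohn Λ U)
    [Nonempty ι] (hx : IsMinimalFamily ρ s x) {v v' : H}
    (hv : v ∈ fixedSpace ρ (nearStabilizer s x)) (hv' : v' ∈ fixedSpace ρ (nearStabilizer s x))
    {g : U ≃ᵢ U} (hg : inner ℂ (ρ g v) v' ≠ 0) :
    ∃ σ : ι → ι, Function.Injective σ ∧ ∀ i,
      localProj ρ (x i) (max s (dist (x i) (g (x (σ i))))) v' ≠ 0 ∧ ∀ u,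
        (v' ∈ localFixed ρ (x i) u → localProj ρ (x (σ i)) u v ≠ 0) ∧
        (v ∈ localFixed ρ (x (σ i)) u → localProj ρ (x i) u v' ≠ 0) := by
  have hσ : ∀ i, ∃ j, ∀ l, dist (x i) (g (x j)) ≤ dist (x i) (g (x l)) :=
    fun i => Finite.exists_min fun j => dist (x i) (g (x j))
  choose σ hσ using hσ
  set t : ι → ℝ := fun i => max s (dist (x i) (g (x (σ i)))) with ht
  set T := fixedProj ρ (nearStabilizer s x) (ρ g v) with hTdef
  have hgv : ρ g v ∈ fixedSpace ρ (nearStabilizer s fun i => g (x i)) :=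
    map_mem_fixedSpace (fun k hk i => by
      rw [← g.dist_eq, ← IsometryEquiv.mul_apply]
      have : g * (g⁻¹ * k * g) = k * g := by group
      rw [this]
      exact hk i) hv
  have hTfix : ∀ k : U ≃ᵢ U, (∀ i, dist (k (x i)) (x i) ≤ t i) → ρ k T = T := fun k hk =>
    hU.map_fixedProj hpos x (fun i => g (x i)) hgv k fun i j =>
      (hk i).trans (max_le_max_left _ (hσ i j))
  have hTv' : inner ℂ T v' ≠ 0 := by rwa [hTdef, inner_fixedProj_of_mem hv']
  have hT0 : T ≠ 0 := fun h => hTv' (by rw [h, inner_zero_left])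
  have hs : ∀ i, s ≤ t i := fun i => le_max_left _ _
  have hTloc := hx.mem_localFixed hs hTfix
  have hdist : ∀ i, dist (x i) (g (x (σ i))) ≤ t i := fun i => le_max_right _ _
  have hTgv : inner ℂ (ρ g v) T ≠ 0 := by
    have h1 : inner ℂ (ρ g v) T = inner ℂ T T := by
      rw [← inner_fixedProj_of_mem (fixedProj_mem ρ _ (ρ g v))]
    rw [h1]
    exact inner_self_ne_zero.2 hT0
  refine ⟨σ, fun i j hij => ?_, fun i => ⟨?_, fun u => ⟨fun hv'u => ?_, fun hvu => ?_⟩⟩⟩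
  -- A common nearest point would put `x i` and `x j` within `max (t i) (t j)` of each other.
  · by_contra hne
    have h1 := hx.lt_dist hT0 hs hTfix hne
    have h2 := hx.lt_dist hT0 hs hTfix (Ne.symm hne)
    have h3 := dist_triangle_max (x i) (g (x (σ i))) (x j)
    have h4 := hdist i
    have h5 := hdist j
    rw [← hij, dist_comm] at h5
    rw [dist_comm (x j)] at h2
    rcases le_max_iff.1 h3 with h | h <;> linarith
  · exact fixedProj_ne_zero (hTloc i) fun h => hTv' (inner_eq_zero_symm.1 h)
  · suffices h : ∃ y ∈ localFixed ρ (g (x (σ i))) u, inner ℂ (ρ g v) y ≠ 0 by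
      obtain ⟨y, hy, hne⟩ := h
      refine fixedProj_ne_zero (inv_map_mem_localFixed g hy) ?_
      rwa [← inner_map_left]
    -- For small `u` the vector `T` is the witness. For large `u` the balls around `x i` and `g (x
    -- (σ i))` coincide, and `v'` itself works.
    rcases le_total u (t i) with hu | hu
    · refine ⟨T, localFixed_anti ρ _ hu ?_, hTgv⟩
      rw [← localFixed_congr (hdist i)]
      exact hTloc i
    · refine ⟨v', ?_, hg⟩
      rwa [← localFixed_congr ((hdist i).trans hu)]
  · rcases le_total u (t i) with hu | hu
    · exact fixedProj_ne_zero (localFixed_anti ρ _ hu (hTloc i)) fun h =>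
        hTv' (inner_eq_zero_symm.1 h)
    · refine fixedProj_ne_zero (w := ρ g v) ?_ fun h => hg (inner_eq_zero_symm.1 h)
      change _ ∈ localFixed ρ (x i) u
      rw [localFixed_congr ((hdist i).trans hu)]
      exact map_mem_localFixed g hvu

/-- For each of the balls `B(x i, u)`, the vector `v` is either fixed by the isometries that are
the identity outside of the ball, or orthogonal to all vectors fixed by them. -/
def IsHomogeneousAt (ρ : (U ≃ᵢ U) →* (H ≃ₗᵢ[ℂ] H)) (x : ι → U) (u : ℝ) (v : H) : Prop :=
  ∀ i, v ∈ localFixed ρ (x i) u ∨ localProj ρ (x i) u v = 0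

omit [IsUltrametricDist U] [Finite ι] in
theorem IsHomogeneousAt.mem {u : ℝ} {v : H} (h : IsHomogeneousAt ρ x u v) {i : ι}
    (hi : localProj ρ (x i) u v ≠ 0) : v ∈ localFixed ρ (x i) u :=
  (h i).resolve_right hi

/-- Project to one local fixed space after another, whenever the result is nonzero; each projection
preserves both alternatives already reached for other balls. -/
theorem IsMinimalFamily.exists_refinement (hx : IsMinimalFamily ρ s x) {v : H}
    (hv : v ∈ fixedSpace ρ (nearStabilizer s x)) (hv0 : v ≠ 0) (F : Finset ℝ) :
    ∃ w ∈ fixedSpace ρ (nearStabilizer s x), w ≠ 0 ∧ (∀ u ∈ F, IsHomogeneousAt ρ x u w) ∧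
      ∀ i u, (v ∈ localFixed ρ (x i) u → w ∈ localFixed ρ (x i) u) ∧
        (localProj ρ (x i) u v = 0 → localProj ρ (x i) u w = 0) := by
  classical
  have := Fintype.ofFinite ι
  suffices h : ∀ F : Finset (ι × ℝ), ∃ w ∈ fixedSpace ρ (nearStabilizer s x), w ≠ 0 ∧
      (∀ p ∈ F, w ∈ localFixed ρ (x p.1) p.2 ∨ localProj ρ (x p.1) p.2 w = 0) ∧
      ∀ i u, (v ∈ localFixed ρ (x i) u → w ∈ localFixed ρ (x i) u) ∧
        (localProj ρ (x i) u v = 0 → localProj ρ (x i) u w = 0) by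
    obtain ⟨w, h₁, h₂, h₃, h₄⟩ := h (Finset.univ ×ˢ F)
    exact ⟨w, h₁, h₂, fun u hu i => h₃ (i, u) (by simpa using hu), h₄⟩
  intro F
  induction F using Finset.induction_on with
  | empty => exact ⟨v, hv, hv0, by simp, fun i u => ⟨id, id⟩⟩
  | insert p F _ ih =>
    obtain ⟨w, h₁, h₂, h₃, h₄⟩ := ih
    by_cases hp : localProj ρ (x p.1) p.2 w = 0
    · refine ⟨w, h₁, h₂, fun q hq => ?_, h₄⟩
      rcases Finset.mem_insert.1 hq with rfl | hq
      · exact Or.inr hp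
      · exact h₃ q hq
    · have hz : ∀ i u, localProj ρ (x i) u w = 0 →
          localProj ρ (x i) u (localProj ρ (x p.1) p.2 w) = 0 := fun i u h =>
        fixedProj_fixedProj_eq_zero (fun y hy => localProj_mem_localFixed _ _ _ _ hy) h
      refine ⟨_, hx.localProj_mem h₁ p.1 p.2, hp, fun q hq => ?_, fun i u => ⟨fun h => ?_, fun h => ?_⟩⟩
      · rcases Finset.mem_insert.1 hq with rfl | hq
        · exact Or.inl (fixedProj_mem ρ _ _)
        · exact (h₃ q hq).imp (fun h => localProj_mem_localFixed _ _ _ _ h) (hz _ _)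
      · exact localProj_mem_localFixed _ _ _ _ ((h₄ i u).1 h)
      · exact hz _ _ ((h₄ i u).2 h)

/-- Some translate of `v` is not orthogonal to `v'`, and the matching then carries one index set
onto the other. -/
theorem IsMinimalFamily.ncard_eq (hpos : ∀ t ∈ Λ, 0 < t) (hU : IsUrysohn Λ U)
    (hirr : IsIrreducible ρ) [Nonempty ι] (hx : IsMinimalFamily ρ s x) {v v' : H}
    (hv : v ∈ fixedSpace ρ (nearStabilizer s x)) (hv' : v' ∈ fixedSpace ρ (nearStabilizer s x))
    (hv0 : v ≠ 0) (hv'0 : v' ≠ 0) {u : ℝ} (hu : IsHomogeneousAt ρ x u v)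
    (hu' : IsHomogeneousAt ρ x u v') :
    {i | v ∈ localFixed ρ (x i) u}.ncard = {i | v' ∈ localFixed ρ (x i) u}.ncard := by
  obtain ⟨g, hg⟩ := hirr.exists_inner_ne_zero hv0 hv'0
  obtain ⟨σ, hσ, h⟩ := hx.exists_matching hpos hU hv hv' hg
  have e : {i | v' ∈ localFixed ρ (x i) u} = σ ⁻¹' {i | v ∈ localFixed ρ (x i) u} := by
    ext i
    exact ⟨fun hi => hu.mem (((h i).2 u).1 hi), fun hi => hu'.mem (((h i).2 u).2 hi)⟩
  rw [e, Set.ncard_preimage_of_injective_subset_range hσ]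
  rw [(Finite.surjective_of_injective hσ).range_eq]
  exact Set.subset_univ _

/-- Finitely many radii suffice: the count of fixed indices takes finitely many values, and index
sets at two radii with equal counts are nested, hence equal. -/
theorem IsMinimalFamily.exists_isHomogeneousAt (hpos : ∀ t ∈ Λ, 0 < t) (hU : IsUrysohn Λ U)
    (hirr : IsIrreducible ρ) [Nonempty ι] (hx : IsMinimalFamily ρ s x)
    (hne : fixedSpace ρ (nearStabilizer s x) ≠ ⊥) :
    ∃ v ∈ fixedSpace ρ (nearStabilizer s x), v ≠ 0 ∧ ∀ u, IsHomogeneousAt ρ x u v := by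
  obtain ⟨v₀, hv₀, hv₀0⟩ := (Submodule.ne_bot_iff _).1 hne
  have h1 : ∀ u : ℝ, ∃ w ∈ fixedSpace ρ (nearStabilizer s x), w ≠ 0 ∧ IsHomogeneousAt ρ x u w :=
    fun u => by
      obtain ⟨w, hw, hw0, h, _⟩ := hx.exists_refinement hv₀ hv₀0 {u}
      exact ⟨w, hw, hw0, h u (Finset.mem_singleton_self u)⟩
  choose w hw hw0 hwu using h1
  set c : ℝ → ℕ := fun u => {i | w u ∈ localFixed ρ (x i) u}.ncard with hc
  have hcard : ∀ v ∈ fixedSpace ρ (nearStabilizer s x), v ≠ 0 → ∀ u : ℝ,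
      IsHomogeneousAt ρ x u v → {i | v ∈ localFixed ρ (x i) u}.ncard = c u :=
    fun v hv hv0 u hu => hx.ncard_eq hpos hU hirr hv (hw u) hv0 (hw0 u) hu (hwu u)
  have hfin : (Set.range c).Finite := (Set.finite_Iic (Nat.card ι)).subset (by
    rintro _ ⟨u, rfl⟩
    exact Set.ncard_le_card _)
  obtain ⟨F, hF⟩ : ∃ F : Finset ℝ, ∀ u, ∃ u' ∈ F, c u' = c u := by
    refine ⟨hfin.toFinset.image (Function.invFun c), fun u => ⟨Function.invFun c (c u), ?_, ?_⟩⟩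
    · exact Finset.mem_image_of_mem _ (hfin.mem_toFinset.2 ⟨u, rfl⟩)
    · exact Function.invFun_eq ⟨u, rfl⟩
  obtain ⟨v, hv, hv0, hvF, -⟩ := hx.exists_refinement hv₀ hv₀0 F
  refine ⟨v, hv, hv0, fun u i => ?_⟩
  obtain ⟨u', hu'F, hu'⟩ := hF u
  have hvu' := hvF u' hu'F
  have hI := (hcard v hv hv0 u' hvu').trans hu'
  -- a refinement of `v` at `u` is fixed for the same balls of radius `u'`
  have key : ∀ w' ∈ fixedSpace ρ (nearStabilizer s x), w' ≠ 0 → IsHomogeneousAt ρ x u w' →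
      (∀ i, (v ∈ localFixed ρ (x i) u' → w' ∈ localFixed ρ (x i) u') ∧
        (localProj ρ (x i) u' v = 0 → localProj ρ (x i) u' w' = 0)) →
      ∀ i, w' ∈ localFixed ρ (x i) u ↔ v ∈ localFixed ρ (x i) u' := by
    intro w' hw' hw'0 hw'u hvw'
    have hback : ∀ i, w' ∈ localFixed ρ (x i) u' → v ∈ localFixed ρ (x i) u' := fun i hi =>
      hvu'.mem fun h0 => hw'0 (by rw [← fixedProj_eq_self hi]; exact (hvw' i).2 h0)
    have hcw := hcard w' hw' hw'0 u hw'u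
    rw [← hI] at hcw
    rcases le_total u u' with hle | hle
    · have hsub : {i | v ∈ localFixed ρ (x i) u'} ⊆ {i | w' ∈ localFixed ρ (x i) u} :=
        fun i hi => localFixed_anti ρ _ hle ((hvw' i).1 hi)
      have := Set.eq_of_subset_of_ncard_le hsub hcw.le
      exact fun i => (Set.ext_iff.1 this i).symm
    · have hsub : {i | w' ∈ localFixed ρ (x i) u} ⊆ {i | v ∈ localFixed ρ (x i) u'} :=
        fun i hi => hback i (localFixed_anti ρ _ hle hi)
      have := Set.eq_of_subset_of_ncard_le hsub hcw.ge
      exact fun i => Set.ext_iff.1 this i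
  by_cases hi : v ∈ localFixed ρ (x i) u'
  · left
    by_contra hcon
    -- If `v` is not fixed at radius `u`, a refinement of its component `y` is fixed there by `key`,
    -- yet has zero projection.
    set y := v - localProj ρ (x i) u v with hy
    have hy0 : y ≠ 0 := fun h => hcon (mem_fixedSpace_of_fixedProj_eq (sub_eq_zero.1 h).symm)
    obtain ⟨w', hw', hw'0, hw'u, hw'r⟩ := hx.exists_refinement
      (Submodule.sub_mem _ hv (hx.localProj_mem hv i u)) hy0 {u}
    have h2 := (key w' hw' hw'0 (hw'u u (Finset.mem_singleton_self u)) (fun j =>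
      ⟨fun h => (hw'r j u').1 (Submodule.sub_mem _ h (localProj_mem_localFixed _ _ _ _ h)),
        fun h => (hw'r j u').2 (by
          rw [map_sub, h, fixedProj_fixedProj_eq_zero
            (fun y hy => localProj_mem_localFixed _ _ _ _ hy) h, sub_zero])⟩) i).2 hi
    refine hw'0 ?_
    rw [← fixedProj_eq_self h2]
    refine (hw'r i u).2 ?_
    rw [map_sub, sub_eq_zero]
    exact (fixedProj_eq_self (fixedProj_mem ρ _ v)).symm
  · right
    by_contra hcon
    obtain ⟨w', hw', hw'0, hw'u, hw'r⟩ := hx.exists_refinement (hx.localProj_mem hv i u) hcon {u}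
    exact hi ((key w' hw' hw'0 (hw'u u (Finset.mem_singleton_self u)) (fun j =>
      ⟨fun h => (hw'r j u').1 (localProj_mem_localFixed _ _ _ _ h),
        fun h => (hw'r j u').2 (fixedProj_fixedProj_eq_zero
            (fun y hy => localProj_mem_localFixed _ _ _ _ hy) h)⟩) i).1
      ((hw'r i u).1 (fixedProj_mem ρ _ v)))

end Homogeneous

/-! ### Embedding an irreducible representation into `ℓ²` of an orbit -/

section OrbitEmbedding

variable {G : Type*} [Group G] {H : Type v} [NormedAddCommGroup H] [InnerProductSpace ℂ H]
  {ρ : G →* (H ≃ₗᵢ[ℂ] H)}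

/-- Schur test for the Gram matrix: its entries are at most `C ^ 2` and its rows have at most `m`
nonzero entries, marked by `r`. -/
theorem norm_sum_smul_sq_le {X : Type u} (F : X → H) {C : ℝ} (hC : ∀ x, ‖F x‖ ≤ C) {m : ℕ}
    (hm : ∀ x, {y | inner ℂ (F x) (F y) ≠ 0}.Finite ∧ {y | inner ℂ (F x) (F y) ≠ 0}.ncard ≤ m)
    (E : Finset X) (c : X → ℂ) :
    ‖∑ x ∈ E, c x • F x‖ ^ 2 ≤ m * C ^ 2 * ∑ x ∈ E, ‖c x‖ ^ 2 := by
  classical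
  set r : X → X → ℝ := fun x y => if inner ℂ (F x) (F y) ≠ 0 then 1 else 0 with hr
  have hr0 : ∀ x y, 0 ≤ r x y := fun x y => by simp only [hr]; split_ifs <;> norm_num
  have hrs : ∀ x y, r x y = r y x := fun x y => by
    simp only [hr, ne_eq, inner_eq_zero_symm (x := F x)]
  have hrow : ∀ x, ∑ y ∈ E, r x y ≤ m := fun x => by
    simp only [hr, Finset.sum_boole]
    refine Nat.cast_le.2 (le_trans ?_ (hm x).2)
    rw [← Set.ncard_coe_finset]
    exact Set.ncard_le_ncard (fun y hy => by simpa using (Finset.mem_filter.1 hy).2) (hm x).1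
  have hC2 : ∀ x y, ‖inner ℂ (F x) (F y)‖ ≤ C ^ 2 * r x y := fun x y => by
    simp only [hr]
    split_ifs with h
    · rw [mul_one, sq]
      exact (norm_inner_le_norm _ _).trans
        (mul_le_mul (hC x) (hC y) (norm_nonneg _) ((norm_nonneg _).trans (hC x)))
    · rw [not_not.1 h]; simp
  have h1 : ‖∑ x ∈ E, c x • F x‖ ^ 2 ≤
      ∑ x ∈ E, ∑ y ∈ E, ‖c x‖ * ‖c y‖ * (C ^ 2 * r x y) := by
    have h2 : ‖∑ x ∈ E, c x • F x‖ ^ 2 =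
        ‖inner ℂ (∑ x ∈ E, c x • F x) (∑ x ∈ E, c x • F x)‖ := by
      rw [inner_self_eq_norm_sq_to_K, norm_pow]; simp
    rw [h2, sum_inner]
    refine (norm_sum_le _ _).trans (Finset.sum_le_sum fun x _ => ?_)
    rw [inner_sum]
    refine (norm_sum_le _ _).trans (Finset.sum_le_sum fun y _ => ?_)
    rw [inner_smul_left, inner_smul_right, norm_mul, norm_mul, RCLike.norm_conj, ← mul_assoc]
    exact mul_le_mul_of_nonneg_left (hC2 x y) (by positivity)
  refine h1.trans ?_
  have h3 : ∀ x y, ‖c x‖ * ‖c y‖ * (C ^ 2 * r x y) ≤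
      C ^ 2 / 2 * (‖c x‖ ^ 2 * r x y) + C ^ 2 / 2 * (‖c y‖ ^ 2 * r y x) := fun x y => by
    rw [hrs y x]
    have := mul_nonneg (mul_nonneg (sq_nonneg C) (hr0 x y)) (sq_nonneg (‖c x‖ - ‖c y‖))
    nlinarith
  have h4 : ∑ x ∈ E, ∑ y ∈ E, ‖c x‖ ^ 2 * r x y ≤ m * ∑ x ∈ E, ‖c x‖ ^ 2 := by
    rw [Finset.mul_sum]
    refine Finset.sum_le_sum fun x _ => ?_
    rw [← Finset.mul_sum, mul_comm]
    exact mul_le_mul_of_nonneg_right (hrow x) (sq_nonneg _)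
  have h5 : ∑ x ∈ E, ∑ y ∈ E, ‖c y‖ ^ 2 * r y x = ∑ x ∈ E, ∑ y ∈ E, ‖c x‖ ^ 2 * r x y :=
    Finset.sum_comm
  calc ∑ x ∈ E, ∑ y ∈ E, ‖c x‖ * ‖c y‖ * (C ^ 2 * r x y)
      ≤ ∑ x ∈ E, ∑ y ∈ E,
        (C ^ 2 / 2 * (‖c x‖ ^ 2 * r x y) + C ^ 2 / 2 * (‖c y‖ ^ 2 * r y x)) :=
      Finset.sum_le_sum fun x _ => Finset.sum_le_sum fun y _ => h3 x y
    _ = C ^ 2 * ∑ x ∈ E, ∑ y ∈ E, ‖c x‖ ^ 2 * r x y := by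
      simp only [Finset.sum_add_distrib, ← Finset.mul_sum, h5]
      ring
    _ ≤ C ^ 2 * (m * ∑ x ∈ E, ‖c x‖ ^ 2) := mul_le_mul_of_nonneg_left h4 (sq_nonneg C)
    _ = m * C ^ 2 * ∑ x ∈ E, ‖c x‖ ^ 2 := by ring

/-- A Bessel type inequality for a family of vectors each of which is orthogonal to all but at most
`m` of the others. -/
theorem sum_norm_inner_sq_le {X : Type u} (F : X → H) {C : ℝ} (hC : ∀ x, ‖F x‖ ≤ C) {m : ℕ}
    (hm : ∀ x, {y | inner ℂ (F x) (F y) ≠ 0}.Finite ∧ {y | inner ℂ (F x) (F y) ≠ 0}.ncard ≤ m)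
    (E : Finset X) (w : H) :
    ∑ x ∈ E, ‖inner ℂ (F x) w‖ ^ 2 ≤ m * C ^ 2 * ‖w‖ ^ 2 := by
  set S := ∑ x ∈ E, ‖inner ℂ (F x) w‖ ^ 2 with hS
  have hS0 : 0 ≤ S := Finset.sum_nonneg fun x _ => sq_nonneg _
  have h1 := norm_sum_smul_sq_le F hC hm E fun x => inner ℂ (F x) w
  rw [← hS] at h1
  have h2 : S ≤ ‖∑ x ∈ E, inner ℂ (F x) w • F x‖ * ‖w‖ := by
    refine le_trans (le_of_eq ?_) (norm_inner_le_norm (𝕜 := ℂ) _ _)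
    rw [sum_inner]
    have h3 : ∀ x ∈ E, inner ℂ (inner ℂ (F x) w • F x) w = ((‖inner ℂ (F x) w‖ ^ 2 : ℝ) : ℂ) := by
      intro x _
      rw [inner_smul_left, RCLike.conj_mul]
      simp
    rw [Finset.sum_congr rfl h3, ← Complex.ofReal_sum, Complex.norm_real, Real.norm_of_nonneg hS0]
  have h4 : S * S ≤ m * C ^ 2 * ‖w‖ ^ 2 * S :=
    calc S * S ≤ (‖∑ x ∈ E, inner ℂ (F x) w • F x‖ * ‖w‖) *
          (‖∑ x ∈ E, inner ℂ (F x) w • F x‖ * ‖w‖) := mul_self_le_mul_self hS0 h2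
      _ = ‖∑ x ∈ E, inner ℂ (F x) w • F x‖ ^ 2 * ‖w‖ ^ 2 := by ring
      _ ≤ (m * C ^ 2 * S) * ‖w‖ ^ 2 := mul_le_mul_of_nonneg_right h1 (sq_nonneg _)
      _ = m * C ^ 2 * ‖w‖ ^ 2 * S := by ring
  rcases hS0.eq_or_lt with h | h
  · rw [← h]; positivity
  · exact le_of_mul_le_mul_right h4 h

/-- The operator of taking matrix elements with respect to a family of vectors. -/
theorem exists_coefficient_map {X : Type u} (F : X → H) {C : ℝ} (hC : ∀ x, ‖F x‖ ≤ C) {m : ℕ}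
    (hm : ∀ x, {y | inner ℂ (F x) (F y) ≠ 0}.Finite ∧ {y | inner ℂ (F x) (F y) ≠ 0}.ncard ≤ m) :
    ∃ T : H →L[ℂ] EllTwo X, ∀ w x, (T w : X → ℂ) x = inner ℂ (F x) w := by
  have hb := sum_norm_inner_sq_le F hC hm
  have hmem : ∀ w, Memℓp (fun x => inner ℂ (F x) w) 2 := fun w =>
    memℓp_gen' (C := m * C ^ 2 * ‖w‖ ^ 2) fun E => by simpa using hb E w
  let T₀ : H →ₗ[ℂ] EllTwo X :=
    { toFun := fun w => ⟨fun x => inner ℂ (F x) w, hmem w⟩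
      map_add' := fun v w => lp.ext (funext fun x => inner_add_right _ _ _)
      map_smul' := fun c w => lp.ext (funext fun x => inner_smul_right _ _ _) }
  refine ⟨T₀.mkContinuous (Real.sqrt (m * C ^ 2)) fun w => ?_, fun w x => rfl⟩
  refine lp.norm_le_of_forall_sum_le (by norm_num) (by positivity) fun E => ?_
  have h : ∑ x ∈ E, ‖(T₀ w : X → ℂ) x‖ ^ 2 ≤ m * C ^ 2 * ‖w‖ ^ 2 := hb E w
  rw [← Real.sq_sqrt (by positivity : (0 : ℝ) ≤ m * C ^ 2), ← mul_pow] at h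
  simpa using h

variable [CompleteSpace H]

/-- Schur's lemma without the spectral theorem: a nonzero eigenspace of `T.adjoint ∘L T` is closed
and invariant, so this operator is a scalar and `T` is a multiple of an isometry. -/
theorem IsIrreducible.exists_isometry_of_eigenvector (hirr : IsIrreducible ρ) {K : Type*}
    [NormedAddCommGroup K] [InnerProductSpace ℂ K] [CompleteSpace K] {π : G →* (K ≃ₗᵢ[ℂ] K)}
    (T : H →L[ℂ] K) (hT : ∀ g w, T (ρ g w) = π g (T w)) (hT0 : T ≠ 0) {w₀ : H} (hw₀ : w₀ ≠ 0)
    {μ : ℂ} (hμ : T.adjoint (T w₀) = μ • w₀) : IsSubrepresentation ρ π := by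
  have hadj : ∀ g w, T.adjoint (T (ρ g w)) = ρ g (T.adjoint (T w)) := fun g w => by
    refine ext_inner_right ℂ fun y => ?_
    rw [inner_map_left, ContinuousLinearMap.adjoint_inner_left,
      ContinuousLinearMap.adjoint_inner_left, hT, hT, inner_map_left]
  let W : Submodule ℂ H := LinearMap.ker ((T.adjoint ∘L T - μ • ContinuousLinearMap.id ℂ H : H →L[ℂ] H) : H →ₗ[ℂ] H)
  have hW : ∀ w, w ∈ W ↔ T.adjoint (T w) = μ • w := fun w => by
    simp [W, LinearMap.mem_ker, sub_eq_zero]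
  have hWc : IsClosed (W : Set H) := by
    have : (W : Set H) = {w | T.adjoint (T w) = μ • w} := Set.ext hW
    rw [this]
    exact isClosed_eq (by fun_prop) (by fun_prop)
  have hWtop : W = ⊤ := by
    refine (hirr.2 W hWc fun g w hw => ?_).resolve_left fun h => hw₀ ?_
    · rw [hW] at hw ⊢
      rw [hadj, hw, map_smul]
    · have : w₀ ∈ W := (hW w₀).2 hμ
      rwa [h] at this
  have hnorm : ∀ w, ‖T w‖ ^ 2 = μ.re * ‖w‖ ^ 2 := fun w => by
    have h1 : T.adjoint (T w) = μ • w := (hW w).1 (hWtop ▸ Submodule.mem_top)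
    have h2 : inner ℂ w (T.adjoint (T w)) = inner ℂ (T w) (T w) :=
      ContinuousLinearMap.adjoint_inner_right _ _ _
    rw [h1, inner_smul_right, inner_self_eq_norm_sq_to_K, inner_self_eq_norm_sq_to_K] at h2
    have h3 := congrArg Complex.re h2
    simp only [Complex.coe_algebraMap, ← Complex.ofReal_pow] at h3
    rw [Complex.re_mul_ofReal, Complex.ofReal_re] at h3
    exact h3.symm
  have hpos : 0 < μ.re := by
    obtain ⟨w, hw⟩ : ∃ w, T w ≠ 0 := by
      by_contra! h
      exact hT0 (ContinuousLinearMap.ext h)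
    have h1 := hnorm w
    have h2 : 0 < ‖T w‖ ^ 2 := by positivity
    rw [h1] at h2
    exact pos_of_mul_pos_left h2 (sq_nonneg _)
  have hs := Real.sqrt_pos.2 hpos
  refine ⟨⟨((Real.sqrt μ.re)⁻¹ : ℂ) • (T : H →ₗ[ℂ] K), fun w => ?_⟩, fun g w => ?_⟩
  · change ‖((Real.sqrt μ.re)⁻¹ : ℂ) • T w‖ = ‖w‖
    have h1 : ‖T w‖ = Real.sqrt μ.re * ‖w‖ := by
      rw [← sq_eq_sq₀ (norm_nonneg _) (by positivity), hnorm, mul_pow, Real.sq_sqrt hpos.le]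
    rw [norm_smul, norm_inv, Complex.norm_real, Real.norm_of_nonneg hs.le, h1,
      inv_mul_cancel_left₀ hs.ne']
  · change ((Real.sqrt μ.re)⁻¹ : ℂ) • T (ρ g w) = π g (((Real.sqrt μ.re)⁻¹ : ℂ) • T w)
    rw [hT, map_smul]

/-- If `v` is fixed by the stabilizer of a point `x₀` of a `G`-set, and if its translates
by the elements outside of a finite extension of this stabilizer are orthogonal to `v`, then an
irreducible representation is contained in `ℓ²` of the `G`-set. -/
theorem IsIrreducible.isSubrepresentation_permRep (hirr : IsIrreducible ρ) {X : Type u}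
    [MulAction G X] (x₀ : X) {v : H} (hv : v ≠ 0) (hst : ∀ g : G, g • x₀ = x₀ → ρ g v = v)
    (N : Subgroup G) (hN : ((fun g : G => g • x₀) '' N).Finite)
    (hz : ∀ g ∉ N, inner ℂ v (ρ g v) = 0) : IsSubrepresentation ρ (permRep G X) := by
  classical
  -- The action need not be transitive, so the orbit map is extended by zero.
  let F : X → H := fun x => if h : ∃ g : G, g • x₀ = x then ρ h.choose v else 0
  have hF : ∀ g : G, F (g • x₀) = ρ g v := fun g => by
    have h : ∃ k : G, k • x₀ = g • x₀ := ⟨g, rfl⟩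
    have h1 : F (g • x₀) = ρ h.choose v := dif_pos h
    rw [h1]
    have h2 := hst (g⁻¹ * h.choose) (by rw [mul_smul, h.choose_spec, inv_smul_smul])
    conv_rhs => rw [← h2, ← map_mul_apply, mul_inv_cancel_left]
  have hF0 : ∀ x, (¬ ∃ g : G, g • x₀ = x) → F x = 0 := fun x h => dif_neg h
  have hFequi : ∀ (g : G) x, F (g • x) = ρ g (F x) := fun g x => by
    by_cases h : ∃ k : G, k • x₀ = x
    · obtain ⟨k, rfl⟩ := h
      rw [← mul_smul, hF, hF, map_mul_apply]
    · rw [hF0 x h, hF0 _ fun ⟨k, hk⟩ => h ⟨g⁻¹ * k, by rw [mul_smul, hk, inv_smul_smul]⟩, map_zero]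
  set S : Set X := (fun g : G => g • x₀) '' N with hS
  have horth : ∀ x ∈ S, ∀ y ∉ S, inner ℂ (F x) (F y) = 0 := by
    rintro _ ⟨n, hn, rfl⟩ y hy
    by_cases h : ∃ k : G, k • x₀ = y
    · obtain ⟨k, rfl⟩ := h
      change inner ℂ (F (n • x₀)) (F (k • x₀)) = 0
      rw [hF, hF, inner_map_left, ← map_mul_apply]
      refine hz _ fun hmem => hy ⟨k, ?_, rfl⟩
      have := N.mul_mem hn hmem
      rwa [mul_inv_cancel_left] at this
    · rw [hF0 y h, inner_zero_right]
  have hx₀S : x₀ ∈ S := ⟨1, N.one_mem, one_smul _ _⟩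
  have hFx₀ : F x₀ = v := by
    have := hF 1
    rwa [one_smul, map_one_apply] at this
  have hFC : ∀ x, ‖F x‖ ≤ ‖v‖ := fun x => by
    by_cases h : ∃ k : G, k • x₀ = x
    · obtain ⟨k, rfl⟩ := h
      rw [hF, (ρ k).norm_map]
    · rw [hF0 x h, norm_zero]; exact norm_nonneg _
  have hm : ∀ x, {y | inner ℂ (F x) (F y) ≠ 0}.Finite ∧
      {y | inner ℂ (F x) (F y) ≠ 0}.ncard ≤ S.ncard := fun x => by
    by_cases h : ∃ k : G, k • x₀ = x
    · obtain ⟨k, rfl⟩ := h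
      have hsub : {y | inner ℂ (F (k • x₀)) (F y) ≠ 0} ⊆ (fun y => k • y) '' S := fun y hy => by
        refine ⟨k⁻¹ • y, ?_, smul_inv_smul k y⟩
        by_contra hcon
        refine hy ?_
        have := horth x₀ hx₀S _ hcon
        rwa [hFequi, hFx₀, ← inner_map_left, ← hF] at this
      exact ⟨(hN.image _).subset hsub, (Set.ncard_le_ncard hsub (hN.image _)).trans
        (Set.ncard_image_le hN)⟩
    · simp [hF0 x h]
  obtain ⟨T, hT⟩ := exists_coefficient_map F hFC hm
  have hTequi : ∀ g w, T (ρ g w) = permRep G X g (T w) := fun g w => lp.ext (funext fun x => by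
    change (T (ρ g w) : X → ℂ) x = (T w : X → ℂ) (g⁻¹ • x)
    rw [hT, hT, hFequi, inner_map_left, inv_inv])
  have hT0 : T ≠ 0 := fun h => hv (by
    have h1 := hT v x₀
    rw [h, hFx₀] at h1
    exact inner_self_eq_zero.1 h1.symm)
  -- The block `S` is finite and its vectors are orthogonal to those outside, so `T.adjoint ∘L T`
  -- preserves this finite-dimensional span and has an eigenvector in it.
  let V₀ : Submodule ℂ H := Submodule.span ℂ (F '' S)
  have hV₀orth : ∀ w ∈ V₀, ∀ x ∉ S, inner ℂ (F x) w = 0 := by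
    intro w hw x hx
    induction hw using Submodule.span_induction with
    | mem w hw =>
      obtain ⟨y, hy, rfl⟩ := hw
      exact inner_eq_zero_symm.1 (horth y hy x hx)
    | zero => exact inner_zero_right _
    | add p q _ _ hp hq => rw [inner_add_right, hp, hq, add_zero]
    | smul c p _ hp => rw [inner_smul_right, hp, mul_zero]
  have hV₀ : ∀ w ∈ V₀, (T.adjoint ∘L T : H →L[ℂ] H) w ∈ V₀ := by
    intro w hw
    have h1 : (T.adjoint ∘L T : H →L[ℂ] H) w = ∑ x ∈ hN.toFinset, inner ℂ (F x) w • F x := by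
      refine ext_inner_right ℂ fun y => ?_
      rw [ContinuousLinearMap.comp_apply, ContinuousLinearMap.adjoint_inner_left,
        lp.inner_eq_tsum, tsum_eq_sum (s := hN.toFinset), sum_inner]
      · refine Finset.sum_congr rfl fun x _ => ?_
        rw [hT, hT, inner_smul_left]
        simp [mul_comm]
      · intro x hx
        rw [hT, hV₀orth w hw x (by simpa using hx), inner_zero_left]
    rw [h1]
    exact Submodule.sum_mem _ fun x hx => Submodule.smul_mem _ _
      (Submodule.subset_span ⟨x, by simpa using hx, rfl⟩)
  have hfd : FiniteDimensional ℂ V₀ := FiniteDimensional.span_of_finite ℂ (hN.image F)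
  have hvV₀ : v ∈ V₀ := Submodule.subset_span ⟨x₀, hx₀S, hFx₀⟩
  have hnt : Nontrivial V₀ := ⟨⟨v, hvV₀⟩, 0, fun h => hv (congrArg Subtype.val h)⟩
  obtain ⟨μ, hμ⟩ := Module.End.exists_eigenvalue
    (((T.adjoint ∘L T : H →L[ℂ] H) : H →ₗ[ℂ] H).restrict hV₀)
  obtain ⟨w, hw⟩ := hμ.exists_hasEigenvector
  refine hirr.exists_isometry_of_eigenvector T hTequi hT0 (w₀ := w) (μ := μ)
    (fun h => hw.2 (Subtype.ext h)) ?_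
  exact congrArg Subtype.val hw.apply_eq_smul

end OrbitEmbedding

/-! ### Tensor products of `ℓ²` spaces -/

section TensorProduct

theorem summable_norm_prod_and_tsum_prod {N : ℕ} {X : Fin N → Type u} (f : ∀ j, X j → ℂ)
    (hf : ∀ j, Summable fun x => ‖f j x‖) :
    (Summable fun ξ : ∀ j, X j => ‖∏ j, f j (ξ j)‖) ∧
      ∑' ξ : ∀ j, X j, ∏ j, f j (ξ j) = ∏ j, ∑' x, f j x := by
  induction N with
  | zero => exact ⟨(hasSum_fintype _).summable, by simp⟩
  | succ N ih =>
    obtain ⟨h₁, h₂⟩ := ih (fun j => f j.succ) fun j => hf j.succ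
    have e : ∀ p : X 0 × (∀ j : Fin N, X j.succ),
        ∏ j, f j (Fin.consEquiv X p j) = f 0 p.1 * ∏ j, f (Fin.succ j) (p.2 j) := fun p => by
      rw [Fin.prod_univ_succ]
      rfl
    constructor
    · rw [← (Fin.consEquiv X).summable_iff]
      refine ((hf 0).mul_norm h₁).congr fun p => ?_
      rw [Function.comp_apply, e]
    · rw [← (Fin.consEquiv X).tsum_eq]
      simp_rw [e]
      rw [← tsum_mul_tsum_of_summable_norm (hf 0) h₁, h₂, Fin.prod_univ_succ]

variable {N : ℕ} {X : Fin N → Type u}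

theorem memlp_prod (v : ∀ j, EllTwo (X j)) :
    Memℓp (fun ξ : ∀ j, X j => ∏ j, (v j : X j → ℂ) (ξ j)) 2 := by
  rw [memℓp_gen_iff (by norm_num)]
  have h := (summable_norm_prod_and_tsum_prod (fun j x => (v j : X j → ℂ) x ^ 2) fun j => by
    have := (memℓp_gen_iff (by norm_num)).1 (lp.memℓp (v j))
    simpa using this).1
  refine h.congr fun ξ => ?_
  rw [Finset.prod_pow, norm_pow]
  simp

/-- Evaluation of square summable functions at a point. -/
noncomputable def ellTwoEval {Y : Type u} (y : Y) : EllTwo Y →ₗ[ℂ] ℂ where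
  toFun f := f y
  map_add' _ _ := rfl
  map_smul' _ _ := rfl

/-- The canonical map of the product of the spaces `ℓ²(X j)` to `ℓ²(∏ X j)`. -/
noncomputable def ellTwoTensor (X : Fin N → Type u) :
    MultilinearMap ℂ (fun j => EllTwo (X j)) (EllTwo (∀ j, X j)) where
  toFun v := ⟨fun ξ => ∏ j, (v j : X j → ℂ) (ξ j), memlp_prod v⟩
  map_update_add' v i a b := by
    refine lp.ext (funext fun ξ => ?_)
    have h := ((MultilinearMap.mkPiAlgebra ℂ (Fin N) ℂ).compLinearMap
      fun j => ellTwoEval (ξ j)).map_update_add v i a b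
    simp only [MultilinearMap.compLinearMap_apply, MultilinearMap.mkPiAlgebra_apply] at h
    rw [lp.coeFn_add, Pi.add_apply]
    exact h
  map_update_smul' v i c a := by
    refine lp.ext (funext fun ξ => ?_)
    have h := ((MultilinearMap.mkPiAlgebra ℂ (Fin N) ℂ).compLinearMap
      fun j => ellTwoEval (ξ j)).map_update_smul v i c a
    simp only [MultilinearMap.compLinearMap_apply, MultilinearMap.mkPiAlgebra_apply] at h
    rw [lp.coeFn_smul, Pi.smul_apply]
    exact h

theorem ellTwoTensor_apply (v : ∀ j, EllTwo (X j)) (ξ : ∀ j, X j) :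
    (ellTwoTensor X v : (∀ j, X j) → ℂ) ξ = ∏ j, (v j : X j → ℂ) (ξ j) := rfl

theorem inner_ellTwoTensor (v w : ∀ j, EllTwo (X j)) :
    inner ℂ (ellTwoTensor X v) (ellTwoTensor X w) = ∏ j, inner ℂ (v j) (w j) := by
  simp_rw [lp.inner_eq_tsum]
  rw [← (summable_norm_prod_and_tsum_prod _ fun j =>
    summable_norm_iff.2 (lp.summable_inner (v j) (w j))).2]
  refine tsum_congr fun ξ => ?_
  simp only [ellTwoTensor_apply, RCLike.inner_apply, map_prod, Finset.prod_mul_distrib]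

theorem dense_span_range_ellTwoTensor :
    Dense (Submodule.span ℂ (Set.range (ellTwoTensor X)) : Set (EllTwo (∀ j, X j))) := by
  classical
  intro f
  refine mem_closure_of_tendsto (lp.hasSum_single (by norm_num) f) (Filter.Eventually.of_forall
    fun E => Submodule.sum_mem _ fun ξ _ => ?_)
  have h : (lp.single 2 ξ (f ξ) : EllTwo (∀ j, X j)) =
      (f ξ : ℂ) • ellTwoTensor X fun j => lp.single 2 (ξ j) (1 : ℂ) := by
    refine lp.ext (funext fun η => ?_)
    rw [lp.coeFn_smul, Pi.smul_apply, ellTwoTensor_apply]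
    by_cases hη : η = ξ
    · subst hη
      simp
    · obtain ⟨j, hj⟩ := Function.ne_iff.1 hη
      rw [lp.single_apply_ne _ _ _ hη, Finset.prod_eq_zero (Finset.mem_univ j), smul_zero]
      exact lp.single_apply_ne _ _ _ hj
  rw [h]
  exact Submodule.smul_mem _ _ (Submodule.subset_span ⟨_, rfl⟩)

/-- The tensor product of permutation representations is the permutation representation
in `ℓ²` on the product. -/
theorem isTensorProduct_permRep (G : Type u) [Group G] (X : Fin N → Type u)
    [∀ j, MulAction G (X j)] :
    IsTensorProduct (fun j => permRep G (X j)) (permRep G (∀ j, X j)) :=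
  ⟨inferInstance, ellTwoTensor X, inner_ellTwoTensor, dense_span_range_ellTwoTensor,
    fun _ _ => lp.ext rfl⟩

end TensorProduct

/-! ### Perfect balls as initial segments of the spectrum -/

section PerfectBalls

variable {Λ : Set ℝ} {U : Type u} [MetricSpace U]

/-- The points whose distance to `a` is zero or lies in `D`. -/
def distBall (D : Set ℝ) (a : U) : Set U := {y | dist y a = 0 ∨ dist y a ∈ D}

theorem self_mem_distBall (D : Set ℝ) (a : U) : a ∈ distBall D a := Or.inl (dist_self a)

theorem image_distBall (g : U ≃ᵢ U) (D : Set ℝ) (a : U) :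
    g '' distBall D a = distBall D (g a) := by
  ext y
  constructor
  · rintro ⟨z, hz, rfl⟩
    change dist (g z) (g a) = 0 ∨ dist (g z) (g a) ∈ D
    rwa [g.dist_eq]
  · intro hy
    refine ⟨g.symm y, ?_, g.apply_symm_apply y⟩
    change dist (g.symm y) a = 0 ∨ dist (g.symm y) a ∈ D
    rwa [← g.dist_eq, g.apply_symm_apply]

theorem IsUrysohn.distBall_eq_of_mem (hpos : ∀ t ∈ Λ, 0 < t) (hU : IsUrysohn Λ U) {D : Set ℝ}
    (hD : ∀ u ∈ D, ∀ t ∈ Λ, t ≤ u → t ∈ D) {a b : U} (hb : b ∈ distBall D a) :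
    distBall D b = distBall D a := by
  have := hU.ultrametric
  have key : ∀ {a b : U}, b ∈ distBall D a → distBall D b ⊆ distBall D a := by
    intro a b hb y hy
    rcases hU.dist_mem y a with h | h
    · exact Or.inl h
    refine Or.inr ?_
    have h0 := hpos _ h
    rcases le_max_iff.1 (dist_triangle_max y b a) with hle | hle
    · rcases hy with hy | hy
      · linarith
      · exact hD _ hy _ h hle
    · rcases hb with hb | hb
      · linarith
      · exact hD _ hb _ h hle
  refine Set.Subset.antisymm (key hb) (key ?_)
  change dist a b = 0 ∨ dist a b ∈ D
  rw [dist_comm]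
  exact hb

theorem mem_ball_closed {a y : U} {t : ℝ} (ht : 0 ≤ t) :
    y ∈ ball BallKind.closed a (ENNReal.ofReal t) ↔ dist y a ≤ t := by
  change edist y a ≤ _ ↔ _
  rw [edist_dist, ENNReal.ofReal_le_ofReal_iff ht]

theorem mem_ball_opened {a y : U} {t : ℝ} (ht : 0 < t) :
    y ∈ ball BallKind.opened a (ENNReal.ofReal t) ↔ dist y a < t := by
  change edist y a < _ ↔ _
  rw [edist_dist, ENNReal.ofReal_lt_ofReal_iff ht]

/-- Initial segments of the spectrum correspond to perfect pairs. -/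
theorem IsUrysohn.exists_isPerfectPair (hpos : ∀ t ∈ Λ, 0 < t) (hU : IsUrysohn Λ U) {D : Set ℝ}
    (hDΛ : D ⊆ Λ) (hD : ∀ u ∈ D, ∀ t ∈ Λ, t ≤ u → t ∈ D)
    (hne : AccPt (0 : ℝ) (Filter.principal Λ) → D.Nonempty) :
    ∃ ε r, IsPerfectPair Λ ε r ∧ ∀ a : U, ball ε a r = distBall D a := by
  have hdist : ∀ y a : U, dist y a = 0 ∨ dist y a ∈ Λ := hU.dist_mem
  -- An empty segment gives radius `0`, allowed by `hne`. Otherwise an attained supremum gives a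
  -- closed ball, an unattained one an open ball, and an unbounded segment the whole space.
  rcases D.eq_empty_or_nonempty with rfl | hDne
  · refine ⟨.closed, ENNReal.ofReal 0,
      ⟨0, Or.inr ⟨rfl, fun h => Set.not_nonempty_empty (hne h)⟩, rfl⟩, fun a => Set.ext fun y => ?_⟩
    rw [mem_ball_closed le_rfl]
    simp [distBall]
  by_cases hb : BddAbove D
  · by_cases hmax : sSup D ∈ D
    · refine ⟨.closed, ENNReal.ofReal (sSup D), ⟨_, Or.inl (hDΛ hmax), rfl⟩,
        fun a => Set.ext fun y => ?_⟩
      have h0 := hpos _ (hDΛ hmax)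
      rw [mem_ball_closed h0.le]
      constructor
      · exact fun h => (hdist y a).imp id fun h' => hD _ hmax _ h' h
      · rintro (h | h)
        · rw [h]; exact h0.le
        · exact le_csSup hb h
    · obtain ⟨s, hs, -, hlim, hsD⟩ :=
        (isLUB_csSup hDne hb).exists_seq_strictMono_tendsto_of_notMem hmax hDne
      refine ⟨.opened, ENNReal.ofReal (sSup D),
        Or.inl ⟨_, ⟨s, hs, fun k => hDΛ (hsD k), hlim⟩, rfl⟩, fun a => Set.ext fun y => ?_⟩
      obtain ⟨u, hu⟩ := hDne
      have h0 : 0 < sSup D := (hpos _ (hDΛ hu)).trans_le (le_csSup hb hu)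
      rw [mem_ball_opened h0]
      constructor
      · intro h
        refine (hdist y a).imp id fun h' => ?_
        obtain ⟨w, hw, hlt⟩ := exists_lt_of_lt_csSup ⟨u, hu⟩ h
        exact hD _ hw _ h' hlt.le
      · rintro (h | h)
        · rw [h]; exact h0
        · exact lt_of_le_of_ne (le_csSup hb h) fun he => hmax (he ▸ h)
  · refine ⟨.opened, ∞, Or.inr ⟨rfl, fun h => hb (h.mono hDΛ)⟩, fun a => Set.ext fun y => ?_⟩
    refine ⟨fun _ => (hdist y a).imp id fun h => ?_, fun _ => edist_lt_top y a⟩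
    rw [not_bddAbove_iff] at hb
    obtain ⟨w, hw, hlt⟩ := hb (dist y a)
    exact hD _ hw _ h hlt.le

end PerfectBalls

/-! ### The family of balls attached to an irreducible representation -/

section Existence

variable {Λ : Set ℝ} {U : Type u} [MetricSpace U] [IsUltrametricDist U]
  {H : Type v} [NormedAddCommGroup H] [InnerProductSpace ℂ H]
  {ρ : (U ≃ᵢ U) →* (H ≃ₗᵢ[ℂ] H)}

theorem nearStabilizer_comp {s : NNReal} {ι κ : Type*} (x : ι → U) (e : κ ≃ ι) :
    nearStabilizer s (x ∘ e) = nearStabilizer s x := by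
  ext g
  exact e.forall_congr_right (q := fun i => dist (g (x i)) (x i) ≤ s)

variable [CompleteSpace H]

theorem exists_fixedSpace_ne_bot [Nonempty U] (hcont : StronglyContinuous ρ) [Nontrivial H] :
    ∃ s : NNReal, 0 < s ∧ ∃ n : ℕ, 0 < n ∧ ∃ x : Fin n → U,
      fixedSpace ρ (nearStabilizer s x) ≠ ⊥ := by
  classical
  obtain ⟨v, hv⟩ := exists_ne (0 : H)
  have hv' : 0 < ‖v‖ := norm_pos_iff.2 hv
  have h1 : {g : U ≃ᵢ U | dist (ρ g v) v < ‖v‖ / 2} ∈ 𝓝 (1 : U ≃ᵢ U) := by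
    have h2 := (hcont v).tendsto 1
    rw [map_one_apply] at h2
    exact h2 (Metric.ball_mem_nhds _ (half_pos hv'))
  rw [nhds_induced, Filter.mem_comap] at h1
  obtain ⟨O, hO, hOsub⟩ := h1
  rw [nhds_pi, Filter.mem_pi] at hO
  obtain ⟨I, hI, t, ht, htO⟩ := hO
  have h2 : ∀ y : U, ∃ δ > 0, Metric.ball y δ ⊆ t y := fun y => Metric.mem_nhds_iff.1 (ht y)
  choose δ hδ hδt using h2
  obtain ⟨s, hs, hsI⟩ : ∃ s : NNReal, 0 < s ∧ ∀ y ∈ I, (s : ℝ) < δ y := by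
    have h3 : ∀ᶠ s : ℝ in 𝓝[>] 0, ∀ y ∈ I, s < δ y := (Filter.eventually_all_finite hI).2
      fun y _ => eventually_nhdsWithin_of_eventually_nhds (eventually_lt_nhds (hδ y))
    obtain ⟨s, h, hs⟩ := (h3.and self_mem_nhdsWithin).exists
    exact ⟨⟨s, (Set.mem_Ioi.1 hs).le⟩, hs, h⟩
  let y₀ : U := Classical.arbitrary U
  -- The extra point `y₀` only makes the family nonempty.
  let J : Finset U := insert y₀ hI.toFinset
  refine ⟨s, hs, J.card, Finset.card_pos.2 ⟨y₀, Finset.mem_insert_self _ _⟩,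
    (fun y : J => (y : U)) ∘ J.equivFin.symm, ?_⟩
  rw [nearStabilizer_comp]
  refine fixedSpace_ne_bot ρ _ (half_lt_self hv') fun g hg => ?_
  rw [← dist_eq_norm]
  refine (hOsub (htO fun y hy => hδt y ?_) : dist (ρ g v) v < ‖v‖ / 2).le
  exact (hg ⟨y, Finset.mem_insert_of_mem (hI.mem_toFinset.2 hy)⟩).trans_lt (hsI y hy)

theorem exists_isMinimalFamily [Nonempty U] (hcont : StronglyContinuous ρ) [Nontrivial H] :
    ∃ s : NNReal, 0 < s ∧ ∃ n : ℕ, 0 < n ∧ ∃ x : Fin n → U,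
      fixedSpace ρ (nearStabilizer s x) ≠ ⊥ ∧ IsMinimalFamily ρ s x := by
  classical
  obtain ⟨s, hs, hex⟩ := exists_fixedSpace_ne_bot (U := U) hcont
  obtain ⟨hn, x, hx⟩ := Nat.find_spec hex
  refine ⟨s, hs, _, hn, x, hx, fun i j hij => ?_⟩
  by_contra hne
  have : Nonempty {l // l ≠ i} := ⟨⟨j, hij.symm⟩⟩
  refine Nat.find_min hex (m := Fintype.card {l // l ≠ i}) ?_ ⟨Fintype.card_pos,
    (fun l : {l // l ≠ i} => x l.1) ∘ (Fintype.equivFin _).symm, ?_⟩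
  · have := Fintype.card_subtype_lt (p := fun l => l ≠ i) (x := i) (by simp)
    rwa [Fintype.card_fin] at this
  · rwa [nearStabilizer_comp]

omit [CompleteSpace H] in
-- Apply `IsMinimalFamily.lt_dist` with radius `s` everywhere except at `i`, where it is raised to
-- `max s u`.
theorem IsMinimalFamily.lt_dist_of_mem_localFixed {s : NNReal} {ι : Type*} [Finite ι] {x : ι → U}
    (hx : IsMinimalFamily ρ s x) {v : H} (hv : v ∈ fixedSpace ρ (nearStabilizer s x))
    (hv0 : v ≠ 0) {i j : ι} (hij : i ≠ j) {u : ℝ} (hu : v ∈ localFixed ρ (x i) u) :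
    u < dist (x i) (x j) := by
  classical
  refine (le_max_right (s : ℝ) u).trans_lt ?_
  have h := hx.lt_dist hv0 (t := Function.update (fun _ => (s : ℝ)) i (max s u)) (fun l => ?_)
    (fun k hk => map_eq_of_mem_localFixed hv (fun l => ?_) hk) hij
  · rwa [Function.update_self] at h
  · by_cases hl : l = i
    · subst hl; rw [Function.update_self]; exact le_max_left _ _
    · rw [Function.update_of_ne hl]
  · by_cases hl : l = i
    · subst hl
      rw [Function.update_self]
      rcases le_total (s : ℝ) u with h | h
      · rwa [max_eq_right h]
      · rw [max_eq_left h]; exact hx.mem_localFixed_of_le hv _ le_rfl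
    · rw [Function.update_of_ne hl]; exact hx.mem_localFixed_of_le hv _ le_rfl

/-- There are disjoint perfect balls and a nonzero vector that is fixed by the stabilizer of these
balls and is orthogonal to its translates by the isometries that do not permute the balls. -/
theorem IsUrysohn.exists_ball_family (hpos : ∀ t ∈ Λ, 0 < t) (hU : IsUrysohn Λ U)
    (hcont : StronglyContinuous ρ) (hirr : IsIrreducible ρ) :
    ∃ N : ℕ, 0 < N ∧ ∃ (ε : Fin N → BallKind) (r : Fin N → ℝ≥0∞) (a : Fin N → U),
      (∀ j, IsPerfectPair Λ (ε j) (r j)) ∧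
      (∀ i j, i ≠ j → Disjoint (ball (ε i) (a i) (r i)) (ball (ε j) (a j) (r j))) ∧
      ∃ v : H, v ≠ 0 ∧
        (∀ g : U ≃ᵢ U, (∀ j, g '' ball (ε j) (a j) (r j) = ball (ε j) (a j) (r j)) → ρ g v = v) ∧
        ∀ g : U ≃ᵢ U, inner ℂ v (ρ g v) ≠ 0 → ∃ σ : Equiv.Perm (Fin N), ∀ j,
          g '' ball (ε (σ j)) (a (σ j)) (r (σ j)) = ball (ε j) (a j) (r j) := by
  have := hU.nonempty hpos
  have := hirr.1
  obtain ⟨s, hs, n, hn, x, hne, hx⟩ := exists_isMinimalFamily (U := U) hcont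
  have : Nonempty (Fin n) := ⟨⟨0, hn⟩⟩
  obtain ⟨v, hv, hv0, hhom⟩ := hx.exists_isHomogeneousAt hpos hU hirr hne
  set D : Fin n → Set ℝ := fun i => {u | u ∈ Λ ∧ v ∈ localFixed ρ (x i) u} with hDdef
  have hD : ∀ i, ∀ u ∈ D i, ∀ t ∈ Λ, t ≤ u → t ∈ D i :=
    fun i u hu t ht htu => ⟨ht, localFixed_anti ρ _ htu hu.2⟩
  have hDne : ∀ i, AccPt (0 : ℝ) (Filter.principal Λ) → (D i).Nonempty := fun i hacc => by
    rw [accPt_iff_nhds] at hacc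
    -- Radii below `s` always belong to `D i`, so radius `0` is not needed when `0` is a limit
    -- point.
    obtain ⟨t, ⟨ht, htΛ⟩, -⟩ := hacc (Metric.ball 0 s) (Metric.ball_mem_nhds _ hs)
    refine ⟨t, htΛ, hx.mem_localFixed_of_le hv i ?_⟩
    rw [Metric.mem_ball, Real.dist_eq, sub_zero] at ht
    exact (le_abs_self t).trans ht.le
  choose ε r hperf hball using fun i =>
    hU.exists_isPerfectPair hpos (D := D i) (fun u hu => hu.1) (hD i) (hDne i)
  have hmem : ∀ i y, y ∈ distBall (D i) (x i) → v ∈ localFixed ρ (x i) (dist y (x i)) := by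
    rintro i y (h | h)
    · rw [h]; exact hx.mem_localFixed_of_le hv i s.2
    · exact h.2
  refine ⟨n, hn, ε, r, x, hperf, fun i j hij => ?_, v, hv0, fun g hg => ?_, fun g hg => ?_⟩
  · rw [hball, hball, Set.disjoint_left]
    intro y hyi hyj
    have h1 := hx.lt_dist_of_mem_localFixed hv hv0 hij (hmem i y hyi)
    have h2 := hx.lt_dist_of_mem_localFixed hv hv0 hij.symm (hmem j y hyj)
    rw [dist_comm (x j)] at h2
    have h3 := dist_le_max_left (x i) (x j) y
    rcases le_max_iff.1 h3 with h | h <;> linarith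
  · refine map_eq_of_mem_localFixed hv (t := fun i => dist (g (x i)) (x i)) (fun i => hmem i _ ?_)
      fun i => le_rfl
    have h1 := hg i
    rw [hball] at h1
    rw [← h1]
    exact ⟨x i, self_mem_distBall _ _, rfl⟩
  · obtain ⟨σ, hσ, h⟩ := hx.exists_matching hpos hU hv hv fun h0 => hg (inner_eq_zero_symm.1 h0)
    refine ⟨Equiv.ofBijective σ (Finite.injective_iff_bijective.1 hσ), fun i => ?_⟩
    -- Matching `v` with itself and using homogeneity, matched balls have the same radii; the
    -- nearest point `g (x (σ i))` lies in the `i`-th ball.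
    have hDσ : D (σ i) = D i := Set.ext fun u => and_congr_right fun _ =>
      ⟨fun hu => (hhom u).mem (((h i).2 u).2 hu), fun hu => (hhom u).mem (((h i).2 u).1 hu)⟩
    rw [Equiv.ofBijective_apply, hball, hball, image_distBall, hDσ]
    refine hU.distBall_eq_of_mem hpos (hD i) ?_
    refine (hU.dist_mem _ _).imp id fun hΛ => ⟨hΛ, ?_⟩
    rw [dist_comm]
    exact localFixed_anti ρ _ (le_max_right _ _) ((hhom _).mem (h i).1)

end Existence

/-! ### Finiteness of the permuting group modulo the stabilizer -/

section Conclusion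

/-- The isometries that permute a family of sets. -/
def permutingSubgroup {U : Type u} [MetricSpace U] {ι : Type*} (B : ι → Set U) :
    Subgroup (U ≃ᵢ U) where
  carrier := {g | ∃ σ : Equiv.Perm ι, ∀ j, g '' B (σ j) = B j}
  one_mem' := ⟨1, fun j => Set.image_id _⟩
  mul_mem' := by
    rintro g h ⟨σ, hσ⟩ ⟨τ, hτ⟩
    refine ⟨τ * σ, fun j => ?_⟩
    change (g ∘ h) '' B (τ (σ j)) = B j
    rw [Set.image_comp, hτ, hσ]
  inv_mem' := by
    rintro g ⟨σ, hσ⟩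
    refine ⟨σ.symm, fun j => ?_⟩
    have h1 := hσ (σ.symm j)
    rw [Equiv.apply_symm_apply] at h1
    rw [← h1, ← Set.image_comp]
    have : (⇑g⁻¹ ∘ ⇑g) = id := funext fun x => IsometryEquiv.inv_apply_self g x
    rw [this, Set.image_id]

/-- A permuting isometry sends the tuple of sets to one of finitely many tuples, and `f` depends
only on that tuple. -/
theorem finite_image_permutingSubgroup {U : Type u} [MetricSpace U] {ι : Type*} [Finite ι]
    (B : ι → Set U) {X : Type*} (f : (U ≃ᵢ U) → X)
    (hf : ∀ g h : U ≃ᵢ U, (∀ j, g '' B j = h '' B j) → f g = f h) :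
    (f '' (permutingSubgroup B : Set (U ≃ᵢ U))).Finite := by
  have h1 : ((fun (g : U ≃ᵢ U) j => g '' B j) '' (permutingSubgroup B : Set (U ≃ᵢ U))).Finite := by
    refine (Set.Finite.pi' fun _ : ι => Set.finite_range B).subset ?_
    rintro _ ⟨g, ⟨σ, hσ⟩, rfl⟩ j
    refine ⟨σ.symm j, ?_⟩
    rw [← hσ, Equiv.apply_symm_apply]
  refine (h1.image fun ξ => f (Function.invFun (fun (g : U ≃ᵢ U) j => g '' B j) ξ)).subset ?_
  rintro _ ⟨g, hg, rfl⟩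
  refine ⟨_, ⟨g, hg, rfl⟩, hf _ _ fun j => ?_⟩
  exact congrFun (Function.invFun_eq (f := fun (g : U ≃ᵢ U) j => g '' B j) ⟨g, rfl⟩) j

end Conclusion

end UltraUrysohn

theorem theorem1 {Λ : Set ℝ} (hcount : Λ.Countable) (hpos : ∀ t ∈ Λ, 0 < t)
    {U : Type u} [MetricSpace U] (hU : UltraUrysohn.IsUrysohn Λ U)
    {H : Type v} [NormedAddCommGroup H] [InnerProductSpace ℂ H] [CompleteSpace H]
    [TopologicalSpace.SeparableSpace H]
    (ρ : (U ≃ᵢ U) →* (H ≃ₗᵢ[ℂ] H))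
    (hcont : UltraUrysohn.StronglyContinuous ρ) (hirr : UltraUrysohn.IsIrreducible ρ) :
    -- ρ is contained in a tensor product of finitely many ℓ² spaces of balls of perfect types
    (∃ N : ℕ, 0 < N ∧ ∃ (ε : Fin N → UltraUrysohn.BallKind) (r : Fin N → ℝ≥0∞),
      (∀ j, UltraUrysohn.IsPerfectPair Λ (ε j) (r j)) ∧
      ∃ (K : Type u) (_ : NormedAddCommGroup K) (_ : InnerProductSpace ℂ K)
        (σ : (U ≃ᵢ U) →* (K ≃ₗᵢ[ℂ] K)),
        UltraUrysohn.IsTensorProduct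
          (fun j => UltraUrysohn.permRep (U ≃ᵢ U) (UltraUrysohn.Balls U (ε j) (r j))) σ ∧
        UltraUrysohn.IsSubrepresentation ρ σ) ∧
    -- ρ is contained in a quasiregular representation
    (∃ N : ℕ, 0 < N ∧ ∃ (ε : Fin N → UltraUrysohn.BallKind) (r : Fin N → ℝ≥0∞) (a : Fin N → U),
      (∀ j, UltraUrysohn.IsPerfectPair Λ (ε j) (r j)) ∧
      (∀ i j, i ≠ j → Disjoint (UltraUrysohn.ball (ε i) (a i) (r i))
        (UltraUrysohn.ball (ε j) (a j) (r j))) ∧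
      UltraUrysohn.IsSubrepresentation ρ
        (UltraUrysohn.permRep (U ≃ᵢ U) ((U ≃ᵢ U) ⧸
          UltraUrysohn.setwiseStabilizer fun j => UltraUrysohn.ball (ε j) (a j) (r j)))) := by
  have := hU.ultrametric
  obtain ⟨N, hN, ε, r, a, hperf, hdisj, v, hv0, hfix, hperm⟩ :=
    hU.exists_ball_family hpos hcont hirr
  set B : Fin N → Set U := fun j => UltraUrysohn.ball (ε j) (a j) (r j) with hB
  have hz : ∀ g ∉ UltraUrysohn.permutingSubgroup B, inner ℂ v (ρ g v) = 0 := fun g hg => by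
    by_contra h
    exact hg (hperm g h)
  refine ⟨⟨N, hN, ε, r, hperf, _, inferInstance, inferInstance, _,
    UltraUrysohn.isTensorProduct_permRep _ _, ?_⟩, N, hN, ε, r, a, hperf, hdisj, ?_⟩
  · let ξ : ∀ j, UltraUrysohn.Balls U (ε j) (r j) := fun j => ⟨B j, a j, rfl⟩
    refine hirr.isSubrepresentation_permRep ξ hv0
      (fun g hg => hfix g fun j => congrArg Subtype.val (congrFun hg j)) _
      (UltraUrysohn.finite_image_permutingSubgroup B _ fun g h hgh => ?_) hz
    exact funext fun j => Subtype.ext (hgh j)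
  · have hmk : ∀ g h : U ≃ᵢ U, (∀ j, g '' B j = h '' B j) →
        g • ((1 : U ≃ᵢ U) : (U ≃ᵢ U) ⧸ UltraUrysohn.setwiseStabilizer B) =
          h • ((1 : U ≃ᵢ U) : (U ≃ᵢ U) ⧸ UltraUrysohn.setwiseStabilizer B) := fun g h hgh => by
      rw [MulAction.Quotient.smul_coe, MulAction.Quotient.smul_coe, QuotientGroup.eq]
      intro j
      simp only [smul_eq_mul, mul_one]
      change (⇑g⁻¹ ∘ ⇑h) '' B j = B j
      rw [Set.image_comp, ← hgh, ← Set.image_comp]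
      have : (⇑g⁻¹ ∘ ⇑g) = id := funext fun x => IsometryEquiv.inv_apply_self g x
      rw [this, Set.image_id]
    refine hirr.isSubrepresentation_permRep
      ((1 : U ≃ᵢ U) : (U ≃ᵢ U) ⧸ UltraUrysohn.setwiseStabilizer B) hv0 (fun g hg => hfix g ?_) _
      (UltraUrysohn.finite_image_permutingSubgroup B _ hmk) hz
    rw [MulAction.Quotient.smul_coe, eq_comm, QuotientGroup.eq] at hg
    simp only [smul_eq_mul, mul_one, inv_one, one_mul] at hg
    exact hg
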